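/- **Proposition 2.5.** Let $N\ge 1$, $T>0$, $\gamma'>1$, $0\le\alpha<\gamma'/N$ and $K\in\mathbb R$. Let $\mathbb T^N=\mathbb R^N/\mathbb Z^N$ be the flat torus and $Q=\mathbb T^N\times(0,T)$. Then there exist constants $C>0$ and $\delta>1$, depending only on $N,T,\gamma',\alpha$ and $K$, such that the following holds. Let $m_0\in C^2(\mathbb T^N)$ with $m_0>0$, $\int_{\mathbb T^N}m_0\,dx=1$ and $\|\nabla m_0\|_{L^\infty(\mathbb T^N)}\le K$. Let $A:Q\to\mathbb R^N$ be a measurable vector field, and let $m\ge 0$ be a weak solution of the Fokker–Planck equation $$m_t-\Delta m+\operatorname{div}(A\,m)=0\ \text{ in }Q,\qquad m(\cdot,0)=m_0\ \text{ on }\mathbb T^N,$$ that is, $m\in L^1(Q)$, $A\,m\in L^1(Q)$ and $$\int_Q m\,(\varphi_t+\Delta\varphi+A\cdot\nabla\varphi)\,dx\,dt+\int_{\mathbb T^N}m_0(x)\,\varphi(x,0)\,dx=0\qquad\text{for all }\varphi\in C_0^\infty(\mathbb T^N\times[0,T)).$$ Suppose that $|A|^{\gamma'}m\in L^1(Q)$,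 set $E=\int_Q|A|^{\gamma'}m\,dx\,dt$, and suppose that $m\in L^{\alpha+1}(Q)$. Then $$\left(\int_Q m^{\alpha+1}\,dx\,dt\right)^{\delta}\le C\,(E+1).$$ -/

import Mathlib

open MeasureTheory
open scoped ContDiff

namespace FokkerPlanck

noncomputable section

/-- The flat torus `𝕋^N = ℝ^N / ℤ^N`. Its `volume` is the product of the normalised Haar measures,
that is, Lebesgue measure on the unit cell, of total mass one. -/
abbrev Torus (N : ℕ) : Type := UnitAddTorus (Fin N)

/-- The canonical projection `ℝ^N → 𝕋^N`. -/
def proj {N : ℕ} (v : EuclideanSpace ℝ (Fin N)) : Torus N := fun i => ((v i : ℝ) : UnitAddCircle)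

/-- A function on the torus is of class `C^k` if the periodic function on `ℝ^N` it induces is. -/
def TorusContDiff {N : ℕ} (k : WithTop ℕ∞) (f : Torus N → ℝ) : Prop :=
  ContDiff ℝ k (fun v : EuclideanSpace ℝ (Fin N) => f (proj v))

/-- The gradient at `x` of a function on the torus, computed in the local chart
`v ↦ x + proj v` centred at `x`. -/
def torusGradient {N : ℕ} (f : Torus N → ℝ) (x : Torus N) : EuclideanSpace ℝ (Fin N) :=
  gradient (fun v : EuclideanSpace ℝ (Fin N) => f (x + proj v)) 0

/-- The Laplacian at `x` of a function on the torus, computed in the same chart. -/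
def torusLaplacian {N : ℕ} (f : Torus N → ℝ) (x : Torus N) : ℝ :=
  Laplacian.laplacian (fun v : EuclideanSpace ℝ (Fin N) => f (x + proj v)) 0

/-- The measure `dx dt` on `Q = 𝕋^N × (0,T)`. -/
def volQ (N : ℕ) (T : ℝ) : Measure (Torus N × ℝ) :=
  (volume : Measure (Torus N)).prod ((volume : Measure ℝ).restrict (Set.Ioo 0 T))

/-- Test functions of class `C_0^∞(𝕋^N × [0,T))`: smooth functions vanishing for all times in some
`[τ, T]` with `τ < T`, but not necessarily at time `0`. (Smooth up to `t = 0` is expressed by having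
a smooth extension to `𝕋^N × ℝ`, whose values at times outside `[0,T)` play no role.) -/
structure IsTestFunction {N : ℕ} (T : ℝ) (φ : Torus N × ℝ → ℝ) : Prop where
  smooth : ContDiff ℝ ∞ (fun p : EuclideanSpace ℝ (Fin N) × ℝ => φ (proj p.1, p.2))
  vanishing : ∃ τ < T, ∀ (x : Torus N) (t : ℝ), τ ≤ t → φ (x, t) = 0

/-- `m` is a weak (distributional) solution on `Q = 𝕋^N × (0,T)` of the Fokker–Planck equation
`m_t - Δ m + div (A m) = 0`, `m(·,0) = m₀`: one has `m, A m ∈ L¹(Q)` and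
`∫_Q m (φ_t + Δ φ + A · ∇φ) dx dt + ∫ m₀ φ(·,0) dx = 0` for all `φ ∈ C_0^∞(𝕋^N × [0,T))`. -/
structure IsWeakSolution {N : ℕ} (T : ℝ) (m₀ : Torus N → ℝ)
    (A : Torus N × ℝ → EuclideanSpace ℝ (Fin N)) (m : Torus N × ℝ → ℝ) : Prop where
  integrable : Integrable m (volQ N T)
  integrable_flux : Integrable (fun p => m p • A p) (volQ N T)
  weak_eq : ∀ φ : Torus N × ℝ → ℝ, IsTestFunction T φ →
    ∫ p, m p * (deriv (fun s => φ (p.1, s)) p.2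
        + torusLaplacian (fun x => φ (x, p.2)) p.1
        + inner ℝ (A p) (torusGradient (fun x => φ (x, p.2)) p.1)) ∂(volQ N T)
      + ∫ x, m₀ x * φ (x, 0) = 0

/-- The energy `E = ∫_Q |A|^{γ'} m dx dt`. -/
def energy {N : ℕ} (T γ' : ℝ) (A : Torus N × ℝ → EuclideanSpace ℝ (Fin N))
    (m : Torus N × ℝ → ℝ) : ℝ :=
  ∫ p, ‖A p‖ ^ γ' * m p ∂(volQ N T)

end

end FokkerPlanck

/-! The estimate rests on one splitting of the solution. Let `e^{hΔ}` be the heat semigroup and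
`F = A m` the flux. Duhamel's formula over a time step `h ≤ 1` writes `m` as the sum of a part
bounded by `C h^{-N/2}`, because `m(·, t)` has mass one and the heat kernel is at most `C h^{-N/2}`,
and a part of size `C √h ‖F‖_{L^q}` in `L^q(Q)`, because `∇ e^{rΔ}` is bounded on `L^q` by
`C r^{-1/2}`, which is integrable at `r = 0`. Choosing `h` according to a height `t` gives the
weak-type bound `|{m > t}| ≤ C ‖F‖_q^q t^{-r}` with `r = q (1 + 1/N)`
(`FokkerPlanck.measure_superlevel_le`). With `p = α + 1` and `1/q = 1/γ' + 1/(γ p)`, where `γ` is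
conjugate to `γ'`, Hölder's inequality gives `‖F‖_q ≤ E^{1/γ'} M^{1/(γ p)}` for `M = ∫ m^p`, and
`r > p` holds exactly when `α < γ'/N`. Interpolating (layer cake) between the weak `L^r` bound and
the mass bound `|{m > t}| ≤ T/t` yields `M ≤ C (1 + E^κ M^{1-κ})^θ` with `κ = q/γ'` and
`θ = α/(r - 1) < 1`. Absorbing the power of `M` gives the claim with
`δ = (1 - θ (1 - κ)) / (θ κ) > 1`.

Solutions are only weak, so the splitting is carried out by duality: for `g` on `Q` the test function
is `φ(·, t) = ∫_0^h e^{rΔ} g(·, t + r) dr`, for which `φ_t + Δφ = e^{hΔ} g(·, t + h) - g`. It is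
evaluated for `g` a trigonometric polynomial in space with smooth coefficients in time
(`FokkerPlanck.integral_mul_trigSum`), where everything is explicit, while the semigroup and its
gradient are at the same time averages of `g` over Gaussian displacements `√(2r) z`, so that all norm
bounds follow from translation invariance (`FokkerPlanck.enorm_integral_mul_trigSum_le`). Such sums
are dense by Stone–Weierstrass, and the estimate passes to indicators of superlevel sets
(`FokkerPlanck.setLIntegral_le_of_approx`). -/

open scoped ENNReal

namespace FokkerPlanck

noncomputable section

variable {N n : ℕ}

/-! ### Fourier modes on the torus -/

/-- The projection `ℝ^N → 𝕋^N` on plain coordinate vectors. -/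
def tproj {N : ℕ} (z : Fin N → ℝ) : Torus N := fun i => ((z i : ℝ) : UnitAddCircle)

/-- The real Fourier mode `cos (2π k · x + θ)` on the torus. -/
def tmode {N : ℕ} (k : Fin N → ℤ) (θ : ℝ) (x : Torus N) : ℝ :=
  (Complex.exp (θ * Complex.I) * UnitAddTorus.mFourier k x).re

theorem proj_eq_tproj (v : EuclideanSpace ℝ (Fin N)) : proj v = tproj (fun i => v i) := rfl

theorem tproj_surjective : Function.Surjective (tproj : (Fin N → ℝ) → Torus N) := by
  intro x
  choose z hz using fun i => QuotientAddGroup.mk_surjective (x i)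
  exact ⟨z, funext hz⟩

theorem tproj_add (z w : Fin N → ℝ) : tproj (z + w) = tproj z + tproj w := by
  ext i; simp [tproj]

theorem continuous_tproj : Continuous (tproj : (Fin N → ℝ) → Torus N) := by
  refine continuous_pi fun i => ?_
  exact (AddCircle.continuous_mk' 1).comp (continuous_apply i)

theorem continuous_tmode (k : Fin N → ℤ) (θ : ℝ) : Continuous (tmode k θ) := by
  unfold tmode
  exact Complex.continuous_re.comp (continuous_const.mul (UnitAddTorus.mFourier k).continuous)

theorem tmode_tproj (k : Fin N → ℤ) (θ : ℝ) (z : Fin N → ℝ) :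
    tmode k θ (tproj z) = Real.cos (θ + 2 * Real.pi * ∑ i, k i * z i) := by
  have h : UnitAddTorus.mFourier k (tproj z)
      = Complex.exp (((2 * Real.pi * ∑ i, k i * z i : ℝ) : ℂ) * Complex.I) := by
    simp only [UnitAddTorus.mFourier, ContinuousMap.coe_mk, tproj, fourier_coe_apply]
    rw [← Complex.exp_sum]
    congr 1
    push_cast
    rw [Finset.mul_sum, Finset.sum_mul]
    refine Finset.sum_congr rfl fun i _ => ?_
    ring
  rw [tmode, h, ← Complex.exp_add, ← add_mul, ← Complex.ofReal_add, Complex.exp_ofReal_mul_I_re]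

theorem abs_tmode_le_one (k : Fin N → ℤ) (θ : ℝ) (x : Torus N) : |tmode k θ x| ≤ 1 := by
  obtain ⟨z, rfl⟩ := tproj_surjective x
  rw [tmode_tproj]
  exact Real.abs_cos_le_one _

/-- Products of modes are sums of modes, so that trigonometric sums form an algebra. -/
theorem tmode_mul (k l : Fin N → ℤ) (θ η : ℝ) (x : Torus N) :
    tmode k θ x * tmode l η x
      = 1 / 2 * tmode (k + l) (θ + η) x + 1 / 2 * tmode (k - l) (θ - η) x := by
  obtain ⟨z, rfl⟩ := tproj_surjective x
  have hs : ∀ a b : ℝ, Real.cos a * Real.cos b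
      = 1 / 2 * Real.cos (a + b) + 1 / 2 * Real.cos (a - b) := by
    intro a b; rw [Real.cos_add, Real.cos_sub]; ring
  simp only [tmode_tproj, hs, Pi.add_apply, Pi.sub_apply]
  congr 3
  · push_cast; simp only [add_mul, Finset.sum_add_distrib]; ring
  · push_cast; simp only [sub_mul, Finset.sum_sub_distrib]; ring

theorem tmode_zero (x : Torus N) : tmode 0 0 x = 1 := by
  obtain ⟨z, rfl⟩ := tproj_surjective x
  simp [tmode_tproj]

/-- The modes separate the points of the torus: the phases `0` and `π/2` recover the real and
imaginary parts of the complex Fourier characters. -/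
theorem exists_tmode_ne {x y : Torus N} (h : x ≠ y) :
    ∃ (k : Fin N → ℤ) (θ : ℝ), tmode k θ x ≠ tmode k θ y := by
  by_contra! H
  refine h (funext fun i => ?_)
  have h1 : UnitAddTorus.mFourier (Pi.single i 1) x = UnitAddTorus.mFourier (Pi.single i 1) y := by
    apply Complex.ext
    · simpa [tmode] using H (Pi.single i 1) 0
    · have := H (Pi.single i 1) (Real.pi / 2)
      simpa [tmode, Complex.exp_pi_div_two_mul_I] using this
  rw [UnitAddTorus.mFourier_single, UnitAddTorus.mFourier_single] at h1
  simp only [fourier_one] at h1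
  exact AddCircle.injective_toCircle one_ne_zero (Circle.ext h1)

/-- The frequency vector `2π k`. -/
def freq (k : Fin N → ℤ) : EuclideanSpace ℝ (Fin N) := WithLp.toLp 2 fun i => 2 * Real.pi * k i

theorem freq_apply (k : Fin N → ℤ) (i : Fin N) : freq k i = 2 * Real.pi * k i := rfl

/-- In the chart centred at `x` a Fourier mode is a plane wave. -/
theorem tmode_chart (k : Fin N → ℤ) (θ : ℝ) (x : Torus N) :
    ∃ c : ℝ, (∀ v : EuclideanSpace ℝ (Fin N),
      tmode k θ (x + proj v) = Real.cos (c + inner ℝ (freq k) v)) ∧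
      tmode k (θ + Real.pi / 2) x = - Real.sin c := by
  obtain ⟨z, rfl⟩ := tproj_surjective x
  refine ⟨θ + 2 * Real.pi * ∑ i, k i * z i, fun v => ?_, ?_⟩
  · rw [proj_eq_tproj, ← tproj_add, tmode_tproj]
    congr 1
    simp only [PiLp.inner_apply, freq_apply, Pi.add_apply, mul_add, Finset.sum_add_distrib,
      add_assoc, Finset.mul_sum]
    congr 2
    refine Finset.sum_congr rfl fun i _ => ?_
    simp; ring
  · rw [tmode_tproj, add_right_comm, Real.cos_add_pi_div_two]

theorem hasFDerivAt_planeWave (B c : ℝ) (κ v : EuclideanSpace ℝ (Fin N)) :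
    HasFDerivAt (fun v => B * Real.cos (c + inner ℝ κ v))
      ((B * -Real.sin (c + inner ℝ κ v)) • innerSL ℝ κ) v := by
  have h1 : HasFDerivAt (fun v => c + inner ℝ κ v) (innerSL ℝ κ) v :=
    ((innerSL ℝ κ).hasFDerivAt (x := v)).const_add c
  have := (h1.cos).const_mul B
  rwa [smul_smul] at this

theorem torusGradient_mul_tmode (B : ℝ) (k : Fin N → ℤ) (θ : ℝ) (x : Torus N) :
    torusGradient (fun x => B * tmode k θ x) x
      = (B * tmode k (θ + Real.pi / 2) x) • freq k := by
  obtain ⟨c, hc, hc'⟩ := tmode_chart k θ x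
  have h : (B * -Real.sin (c + inner ℝ (freq k) 0)) • innerSL ℝ (freq k)
      = InnerProductSpace.toDual ℝ _ ((B * -Real.sin c) • freq k) := by
    ext v; simp
  simp only [torusGradient, hc, gradient, (hasFDerivAt_planeWave B c (freq k) 0).fderiv, hc']
  rw [h, LinearIsometryEquiv.symm_apply_apply]

theorem torusLaplacian_mul_tmode (B : ℝ) (k : Fin N → ℤ) (θ : ℝ) (x : Torus N) :
    torusLaplacian (fun x => B * tmode k θ x) x = - ‖freq k‖ ^ 2 * (B * tmode k θ x) := by
  obtain ⟨c, hc, -⟩ := tmode_chart k θ x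
  have h0 : tmode k θ x = Real.cos c := by
    have := hc 0
    have h00 : proj (0 : EuclideanSpace ℝ (Fin N)) = 0 := by ext i; simp [proj]
    simpa [h00] using this
  simp only [torusLaplacian, hc]
  rw [InnerProductSpace.laplacian_eq_iteratedFDeriv_orthonormalBasis _
    (EuclideanSpace.basisFun (Fin N) ℝ)]
  have h1 : fderiv ℝ (fun v => B * Real.cos (c + inner ℝ (freq k) v))
      = fun v => (B * -Real.sin (c + inner ℝ (freq k) v)) • innerSL ℝ (freq k) :=
    funext fun v => (hasFDerivAt_planeWave B c (freq k) v).fderiv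
  have h2 : fderiv ℝ (fun v => (B * -Real.sin (c + inner ℝ (freq k) v)) • innerSL ℝ (freq k)) 0
      = ((B * -Real.cos c) • innerSL ℝ (freq k)).smulRight (innerSL ℝ (freq k)) := by
    have h3 : HasFDerivAt (fun v => c + inner ℝ (freq k) v) (innerSL ℝ (freq k)) 0 :=
      ((innerSL ℝ (freq k)).hasFDerivAt (x := 0)).const_add c
    have := (((h3.sin).neg).const_mul B).smul_const (innerSL ℝ (freq k))
    refine this.fderiv.trans ?_
    simp [mul_smul]
  simp only [iteratedFDeriv_two_apply, h1, h2, h0]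
  simp only [EuclideanSpace.real_norm_sq_eq, EuclideanSpace.basisFun_apply,
    ContinuousLinearMap.smulRight_apply, smul_apply, smul_eq_mul,
    innerSL_apply_apply, Matrix.cons_val_zero, Matrix.cons_val_one, EuclideanSpace.inner_single_right,
    neg_mul, Finset.sum_mul, ← Finset.sum_neg_distrib]
  simp
  refine Finset.sum_congr rfl fun i _ => ?_
  ring

theorem isTestFunction_mul_tmode {T τ : ℝ} (hτ : τ < T) {b : ℝ → ℝ} (hb : ContDiff ℝ ∞ b)
    (hb0 : ∀ t, τ ≤ t → b t = 0) (k : Fin N → ℤ) (θ : ℝ) :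
    IsTestFunction T (fun p : Torus N × ℝ => b p.2 * tmode k θ p.1) := by
  refine ⟨?_, τ, hτ, fun x t ht => by simp [hb0 t ht]⟩
  simp only [proj_eq_tproj, tmode_tproj]
  refine (hb.comp contDiff_snd).mul (Real.contDiff_cos.comp ?_)
  refine contDiff_const.add (contDiff_const.mul (ContDiff.sum fun i _ => ?_))
  refine contDiff_const.mul ?_
  exact (EuclideanSpace.proj (𝕜 := ℝ) i).contDiff.comp contDiff_fst

/-! ### Gaussian averages of Fourier modes -/

section Gaussian

open ProbabilityTheory

/-- The standard Gaussian measure on `ℝ^N`. -/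
def gauss (N : ℕ) : Measure (Fin N → ℝ) := Measure.pi fun _ => gaussianReal 0 1

instance : IsProbabilityMeasure (gauss N) := by unfold gauss; infer_instance

/-- The displacement `√(2r) z` on the torus: for `z` standard Gaussian, this is the position at time
`r` of the diffusion generated by `Δ`. -/
def heatShift (r : ℝ) (z : Fin N → ℝ) : Torus N := tproj (√(2 * r) • z)

theorem integrable_cexp_gaussianReal (ξ : ℝ) :
    Integrable (fun z : ℝ => Complex.exp (ξ * z * Complex.I)) (gaussianReal 0 1) := by
  refine (integrable_const (1 : ℝ)).mono' (by fun_prop) (ae_of_all _ fun z => ?_)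
  rw [← Complex.ofReal_mul, Complex.norm_exp_ofReal_mul_I]

theorem integrable_mul_cexp_gaussianReal (ξ : ℝ) :
    Integrable (fun z : ℝ => z * Complex.exp (ξ * z * Complex.I)) (gaussianReal 0 1) := by
  have h : Integrable (fun z : ℝ => ‖z‖) (gaussianReal 0 1) :=
    ((memLp_id_gaussianReal (μ := 0) (v := 1) 1).integrable le_rfl).norm
  refine h.mono' (by fun_prop) (ae_of_all _ fun z => ?_)
  rw [norm_mul, ← Complex.ofReal_mul, Complex.norm_exp_ofReal_mul_I, mul_one, Complex.norm_real]

theorem integral_cexp_gaussianReal (ξ : ℝ) :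
    ∫ z : ℝ, Complex.exp (ξ * z * Complex.I) ∂gaussianReal 0 1 = Complex.exp (-(ξ ^ 2 / 2)) := by
  rw [← charFun_apply_real, charFun_gaussianReal]
  congr 1
  simp

theorem integral_mul_cexp_gaussianReal (ξ : ℝ) :
    ∫ z : ℝ, z * Complex.exp (ξ * z * Complex.I) ∂gaussianReal 0 1
      = Complex.I * ξ * Complex.exp (-(ξ ^ 2 / 2)) := by
  have h1 := iteratedDeriv_charFun (n := 1) (t := ξ) (μ := gaussianReal 0 1)
    (by exact_mod_cast memLp_id_gaussianReal (μ := 0) (v := 1) 1)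
  have h2 : charFun (gaussianReal 0 1) = fun ξ : ℝ => Complex.exp (-((ξ : ℂ) ^ 2 / 2)) := by
    ext ξ; rw [charFun_gaussianReal]; congr 1; simp
  have h3 : HasDerivAt (fun ξ : ℝ => Complex.exp (-((ξ : ℂ) ^ 2 / 2)))
      (Complex.exp (-((ξ : ℂ) ^ 2 / 2)) * (-ξ)) ξ := by
    have h4 : HasDerivAt (fun ξ : ℝ => ((ξ : ℂ))) 1 ξ := Complex.ofRealCLM.hasDerivAt
    have h5 := (((h4.pow 2).div_const 2).neg).cexp
    refine h5.congr_deriv ?_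
    simp only [Pi.neg_apply, Pi.pow_apply]
    norm_num
  rw [h2, iteratedDeriv_one, h3.deriv] at h1
  simp only [pow_one] at h1
  have : Complex.I * (Complex.I * ∫ z : ℝ, z * Complex.exp (ξ * z * Complex.I) ∂gaussianReal 0 1)
      = Complex.I * (Complex.exp (-((ξ : ℂ) ^ 2 / 2)) * (-ξ)) := by rw [← h1]
  rw [← mul_assoc, Complex.I_mul_I] at this
  linear_combination -this

theorem integrable_prod_cexp_gauss (ξ : Fin N → ℝ) :
    Integrable (fun z => ∏ j, Complex.exp (ξ j * z j * Complex.I)) (gauss N) :=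
  Integrable.fintype_prod (f := fun j (z : ℝ) => Complex.exp (ξ j * z * Complex.I))
    fun j => integrable_cexp_gaussianReal (ξ j)

theorem integral_prod_cexp_gauss (ξ : Fin N → ℝ) :
    ∫ z, ∏ j, Complex.exp (ξ j * z j * Complex.I) ∂gauss N
      = Complex.exp (-((∑ j, ξ j ^ 2) / 2 : ℝ)) := by
  rw [gauss, integral_fintype_prod_eq_prod (fun j (z : ℝ) => Complex.exp (ξ j * z * Complex.I))]
  simp_rw [integral_cexp_gaussianReal]
  rw [← Complex.exp_sum]
  congr 1
  push_cast
  rw [Finset.sum_neg_distrib, Finset.sum_div]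

theorem mul_prod_cexp_eq (ξ : Fin N → ℝ) (i : Fin N) (z : Fin N → ℝ) :
    (z i : ℂ) * ∏ j, Complex.exp (ξ j * z j * Complex.I)
      = ∏ j, (if j = i then (z j : ℂ) else 1) * Complex.exp (ξ j * z j * Complex.I) := by
  rw [Finset.prod_mul_distrib]; simp

theorem integrable_mul_prod_cexp_gauss (ξ : Fin N → ℝ) (i : Fin N) :
    Integrable (fun z => (z i : ℂ) * ∏ j, Complex.exp (ξ j * z j * Complex.I)) (gauss N) := by
  simp_rw [mul_prod_cexp_eq]
  refine Integrable.fintype_prod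
    (f := fun j (z : ℝ) => (if j = i then (z : ℂ) else 1) * Complex.exp (ξ j * z * Complex.I))
    fun j => ?_
  by_cases h : j = i
  · simpa [h] using integrable_mul_cexp_gaussianReal (ξ i)
  · simpa [h] using integrable_cexp_gaussianReal (ξ j)

theorem integral_mul_prod_cexp_gauss (ξ : Fin N → ℝ) (i : Fin N) :
    ∫ z, (z i : ℂ) * ∏ j, Complex.exp (ξ j * z j * Complex.I) ∂gauss N
      = Complex.I * ξ i * Complex.exp (-((∑ j, ξ j ^ 2) / 2 : ℝ)) := by
  simp_rw [mul_prod_cexp_eq]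
  rw [gauss, integral_fintype_prod_eq_prod
    (fun j (z : ℝ) => (if j = i then (z : ℂ) else 1) * Complex.exp (ξ j * z * Complex.I))]
  have h : ∀ j, ∫ z : ℝ, (if j = i then (z : ℂ) else 1) * Complex.exp (ξ j * z * Complex.I)
      ∂gaussianReal 0 1 = (if j = i then Complex.I * ξ j else 1) * Complex.exp (-(ξ j ^ 2 / 2)) := by
    intro j
    by_cases h : j = i
    · simpa [h] using integral_mul_cexp_gaussianReal (ξ i)
    · simpa [h] using integral_cexp_gaussianReal (ξ j)
  simp_rw [h]
  rw [Finset.prod_mul_distrib, ← Complex.exp_sum]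
  simp [Finset.sum_div]

/-- A shifted Fourier mode, as the real part of a product of one-variable exponentials. -/
theorem tmode_add_heatShift (k : Fin N → ℤ) (θ r : ℝ) (x : Torus N) :
    ∃ c : ℂ, (∀ z, tmode k θ (x + heatShift r z)
        = (c * ∏ j, Complex.exp ((√(2 * r) * freq k j : ℝ) * z j * Complex.I)).re) ∧
      tmode k θ x = c.re ∧ tmode k (θ + Real.pi / 2) x = (c * Complex.I).re := by
  obtain ⟨w, rfl⟩ := tproj_surjective x
  refine ⟨Complex.exp ((θ + 2 * Real.pi * ∑ i, k i * w i : ℝ) * Complex.I), fun z => ?_, ?_, ?_⟩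
  · rw [heatShift, ← tproj_add, tmode_tproj, ← Complex.exp_sum, ← Complex.exp_add,
      ← Complex.exp_ofReal_mul_I_re]
    congr 2
    push_cast
    simp only [Pi.add_apply, Pi.smul_apply, smul_eq_mul, freq_apply, Finset.mul_sum,
      add_mul, Finset.sum_mul, add_assoc]
    push_cast
    simp only [mul_add, Finset.sum_add_distrib, add_mul]
    congr 2
    refine Finset.sum_congr rfl fun i _ => ?_
    ring
  · rw [tmode_tproj, Complex.exp_ofReal_mul_I_re]
  · rw [tmode_tproj, add_right_comm, Real.cos_add_pi_div_two, Complex.mul_I_re,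
      Complex.exp_ofReal_mul_I_im]

theorem sum_sq_freq (k : Fin N → ℤ) {r : ℝ} (hr : 0 ≤ r) :
    (∑ j, (√(2 * r) * freq k j) ^ 2) / 2 = ‖freq k‖ ^ 2 * r := by
  simp only [mul_pow, ← Finset.mul_sum, EuclideanSpace.real_norm_sq_eq]
  rw [Real.sq_sqrt (by positivity)]
  ring

/-- The heat semigroup acts on a Fourier mode by averaging over a Gaussian displacement. -/
theorem integral_tmode_heatShift (k : Fin N → ℤ) (θ : ℝ) {r : ℝ} (hr : 0 ≤ r) (x : Torus N) :
    ∫ z, tmode k θ (x + heatShift r z) ∂gauss N = Real.exp (-(‖freq k‖ ^ 2 * r)) * tmode k θ x := by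
  obtain ⟨c, hc, hc1, -⟩ := tmode_add_heatShift k θ r x
  simp_rw [hc]
  have hi := (integrable_prod_cexp_gauss (fun j => √(2 * r) * freq k j)).const_mul c
  have := integral_re hi
  simp only [RCLike.re_to_complex] at this
  rw [this, integral_const_mul, integral_prod_cexp_gauss, sum_sq_freq k hr, hc1,
    ← Complex.ofReal_neg, ← Complex.ofReal_exp, Complex.re_mul_ofReal, mul_comm]

/-- Gaussian integration by parts for Fourier modes: the derivative `∂_i` of the heat semigroup is
an average against the weight `z_i`, at the cost of a factor `(2r)^{-1/2}`. -/
theorem integral_mul_tmode_heatShift (k : Fin N → ℤ) (θ : ℝ) {r : ℝ} (hr : 0 ≤ r) (x : Torus N)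
    (i : Fin N) :
    ∫ z, z i * tmode k θ (x + heatShift r z) ∂gauss N
      = √(2 * r) * (Real.exp (-(‖freq k‖ ^ 2 * r)) * (freq k i * tmode k (θ + Real.pi / 2) x)) := by
  obtain ⟨c, hc, -, hc1⟩ := tmode_add_heatShift k θ r x
  have hi := (integrable_mul_prod_cexp_gauss (fun j => √(2 * r) * freq k j) i).const_mul c
  have := integral_re hi
  simp only [RCLike.re_to_complex] at this
  have h2 : ∀ z : Fin N → ℝ, z i * tmode k θ (x + heatShift r z) = (c * (z i *
      ∏ j, Complex.exp ((√(2 * r) * freq k j : ℝ) * z j * Complex.I))).re := by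
    intro z
    rw [hc, ← Complex.re_ofReal_mul]
    congr 1; ring
  simp_rw [h2]
  rw [this, integral_const_mul, integral_mul_prod_cexp_gauss, sum_sq_freq k hr, hc1,
    ← Complex.ofReal_neg, ← Complex.ofReal_exp]
  have : c * (Complex.I * (√(2 * r) * freq k i : ℝ) * (Real.exp (-(‖freq k‖ ^ 2 * r)) : ℝ))
    = ((√(2 * r) * freq k i * Real.exp (-(‖freq k‖ ^ 2 * r)) : ℝ) : ℂ) * (c * Complex.I) := by
    push_cast; ring
  rw [this, Complex.re_ofReal_mul]
  ring

end Gaussian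

/-! ### The heat kernel bound on the torus -/

section Gaussian

open ProbabilityTheory

/-- Density bounds multiply under finite products of measures. -/
theorem pi_le_smul_pi {ι : Type*} [Fintype ι] {X : ι → Type*} [∀ i, MeasurableSpace (X i)]
    {μ ν : ∀ i, Measure (X i)} [∀ i, SigmaFinite (μ i)] [∀ i, SigmaFinite (ν i)] {c : ℝ≥0∞}
    (hc : c ≠ ⊤) (h : ∀ i, μ i ≤ c • ν i) :
    Measure.pi μ ≤ c ^ Fintype.card ι • Measure.pi ν := by
  lift c to NNReal using hc
  have : ∀ i, SigmaFinite ((c : ℝ≥0∞) • ν i) := fun i => by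
    change SigmaFinite (c • ν i); infer_instance
  have h1 : Measure.pi (fun i => (c : ℝ≥0∞) • ν i) = (c : ℝ≥0∞) ^ Fintype.card ι • Measure.pi ν := by
    refine Measure.pi_eq fun s _ => ?_
    simp [Measure.pi_pi, Finset.prod_mul_distrib]
  rw [← h1]
  refine Measure.le_iff.2 fun s hs => ?_
  rw [Measure.pi, Measure.pi, toMeasure_apply _ _ hs, toMeasure_apply _ _ hs]
  refine (OuterMeasure.le_pi.2 fun s _ => ?_ :
    OuterMeasure.pi (fun i => (μ i).toOuterMeasure)
      ≤ OuterMeasure.pi fun i => ((c : ℝ≥0∞) • ν i).toOuterMeasure) s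
  refine (OuterMeasure.pi_pi_le _ _).trans (Finset.prod_le_prod' fun i _ => ?_)
  exact h i _

theorem summable_exp_neg_abs_int : Summable fun k : ℤ => Real.exp (-|(k : ℝ)|) := by
  have h : Summable fun n : ℕ => Real.exp (-(n : ℝ)) := Real.summable_exp_neg_nat
  refine Summable.of_nat_of_neg ?_ ?_ <;> simpa using h

/-- A bound of the Gaussian density on unit cells that is summable over the cells, using only that
the variance `2r` is at most `2`. -/
theorem gaussianPDFReal_le {r : ℝ} (hr : 0 < r) (hr1 : r ≤ 1) {v : NNReal} (hv : (v : ℝ) = 2 * r)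
    {k : ℤ} {x : ℝ} (hx : x ∈ Set.Ioc (k : ℝ) (k + 1)) :
    gaussianPDFReal 0 v x ≤ (√r)⁻¹ * (Real.exp 2 * Real.exp (-|(k : ℝ)|)) := by
  rw [gaussianPDFReal, hv, ← Real.exp_add]
  gcongr
  · nlinarith [Real.pi_gt_three]
  · have h1 : |(k : ℝ)| ≤ |x| + 1 := by
      have : |(k : ℝ) - x| ≤ 1 := by rw [abs_le]; constructor <;> linarith [hx.1, hx.2]
      linarith [abs_sub_abs_le_abs_sub (k : ℝ) x]
    have h2 : -(x - 0) ^ 2 / (2 * (2 * r)) ≤ -(x ^ 2 / 4) := by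
      rw [neg_div, neg_le_neg_iff, sub_zero]
      exact div_le_div_of_nonneg_left (sq_nonneg x) (by linarith) (by linarith)
    nlinarith [sq_nonneg (|x| - 2), sq_abs x]

/-- On the circle, the Gaussian of variance `2r ≤ 2` has density at most `C r^{-1/2}`. -/
theorem exists_map_gaussianReal_le : ∃ C : ℝ, 0 < C ∧ ∀ r : ℝ, 0 < r → r ≤ 1 →
    (gaussianReal 0 1).map (fun z => ((√(2 * r) * z : ℝ) : UnitAddCircle))
      ≤ ENNReal.ofReal (C / √r) • volume := by
  set D := ∑' k : ℤ, Real.exp (-|(k : ℝ)|) with hD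
  have hDpos : 0 < D := summable_exp_neg_abs_int.tsum_pos (fun _ => (Real.exp_pos _).le) 0
    (Real.exp_pos _)
  refine ⟨Real.exp 2 * D, by positivity, fun r hr hr1 => ?_⟩
  set v : NNReal := .mk ((√(2 * r)) ^ 2) (sq_nonneg _) * 1 with hv
  have hv' : (v : ℝ) = 2 * r := by
    simp only [hv, mul_one, NNReal.coe_mk]
    rw [Real.sq_sqrt (by positivity)]
  have hv0 : v ≠ 0 := by
    intro h; rw [h] at hv'; simp at hv'; linarith
  have hmk : Measurable (fun z : ℝ => (z : UnitAddCircle)) := AddCircle.measurable_mk'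
  have h1 : (gaussianReal 0 1).map (fun z => ((√(2 * r) * z : ℝ) : UnitAddCircle))
      = (gaussianReal 0 v).map (fun z : ℝ => (z : UnitAddCircle)) := by
    have := gaussianReal_map_const_mul (μ := 0) (v := 1) (√(2 * r))
    rw [mul_zero] at this
    rw [hv, ← this, Measure.map_map hmk (by fun_prop)]
    rfl
  rw [h1]
  refine Measure.le_iff.2 fun s hs => ?_
  rw [Measure.map_apply hmk hs, ← lintegral_indicator_one (hmk hs),
    gaussianReal_of_var_ne_zero _ hv0, lintegral_withDensity_eq_lintegral_mul _
      (measurable_gaussianPDF 0 v) (measurable_one.indicator (hmk hs)), ← setLIntegral_univ,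
    ← iUnion_Ioc_intCast ℝ, lintegral_iUnion (fun _ => measurableSet_Ioc)
      (Set.pairwise_disjoint_Ioc_intCast ℝ)]
  calc ∑' k : ℤ, ∫⁻ x in Set.Ioc (k : ℝ) (k + 1),
        (gaussianPDF 0 v * Set.indicator ((fun z : ℝ => (z : UnitAddCircle)) ⁻¹' s) 1 : ℝ → ℝ≥0∞) x
      ≤ ∑' k : ℤ, ENNReal.ofReal ((√r)⁻¹ * (Real.exp 2 * Real.exp (-|(k : ℝ)|))) * volume s := by
        refine ENNReal.tsum_le_tsum fun k => ?_
        rw [← lintegral_indicator_one hs, ← UnitAddCircle.lintegral_preimage (k : ℝ),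
          ← lintegral_const_mul' _ _ ENNReal.ofReal_ne_top]
        refine setLIntegral_mono' measurableSet_Ioc fun x hx => ?_
        rw [Pi.mul_apply, gaussianPDF]
        gcongr
        · exact gaussianPDFReal_le hr hr1 hv' hx
        · exact le_of_eq rfl
    _ = ENNReal.ofReal (Real.exp 2 * D / √r) * volume s := by
        rw [ENNReal.tsum_mul_right, ← ENNReal.ofReal_tsum_of_nonneg (fun k => by positivity)
          ((summable_exp_neg_abs_int.mul_left _).mul_left _), tsum_mul_left, tsum_mul_left]
        congr 2
        rw [div_eq_inv_mul]

theorem measurable_heatShift : Measurable fun y : ℝ × (Fin N → ℝ) => heatShift y.1 y.2 := by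
  refine continuous_tproj.measurable.comp ?_
  fun_prop

/-- Ultracontractivity of the heat semigroup on the torus: for `r ≤ 1` the heat kernel is bounded by
`C r^{-N/2}`. -/
theorem exists_map_heatShift_le (N : ℕ) : ∃ C : ℝ, 0 < C ∧ ∀ r : ℝ, 0 < r → r ≤ 1 →
    (gauss N).map (heatShift r) ≤ ENNReal.ofReal ((C / √r) ^ N) • (volume : Measure (Torus N)) := by
  obtain ⟨C, hC, h⟩ := exists_map_gaussianReal_le
  refine ⟨C, hC, fun r hr hr1 => ?_⟩
  have hf : Measurable (fun z : ℝ => ((√(2 * r) * z : ℝ) : UnitAddCircle)) :=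
    AddCircle.measurable_mk'.comp (by fun_prop)
  have : IsProbabilityMeasure ((gaussianReal 0 1).map
      (fun z => ((√(2 * r) * z : ℝ) : UnitAddCircle))) :=
    Measure.isProbabilityMeasure_map hf.aemeasurable
  have h1 := Measure.pi_map_pi (ι := Fin N) (μ := fun _ => gaussianReal 0 1)
    (f := fun _ z => ((√(2 * r) * z : ℝ) : UnitAddCircle)) fun _ => hf.aemeasurable
  have h2 : (fun (z : Fin N → ℝ) i => ((√(2 * r) * z i : ℝ) : UnitAddCircle)) = heatShift r := by
    ext z i; simp [heatShift, tproj]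
  rw [h2] at h1
  rw [gauss, h1, ENNReal.ofReal_pow (by positivity)]
  refine (pi_le_smul_pi (ν := fun _ => volume) ENNReal.ofReal_ne_top fun _ => h r hr hr1).trans ?_
  rw [Fintype.card_fin]
  exact le_of_eq rfl

end Gaussian

/-! ### Tests with Fourier modes and conservation of mass -/

instance : IsProbabilityMeasure (volume : Measure (Torus N)) := by
  have : IsProbabilityMeasure (volume : Measure UnitAddCircle) := ⟨UnitAddCircle.measure_univ⟩
  exact inferInstanceAs (IsProbabilityMeasure (Measure.pi fun _ : Fin N => volume))

instance {T : ℝ} : IsFiniteMeasure (volQ N T) := by unfold volQ; infer_instance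

/-- The time profile of the test function: `∫_0^h e^{-λ r} a(s + r) dr`. -/
def timeAverage (l h : ℝ) (a : ℝ → ℝ) (s : ℝ) : ℝ := ∫ r in (0)..h, Real.exp (-(l * r)) * a (s + r)

theorem contDiff_integral_of_contDiff {f : ℝ → ℝ} (hf : ContDiff ℝ ∞ f) :
    ContDiff ℝ ∞ (fun s => ∫ r in (0)..s, f r) := by
  have h : ∀ s, HasDerivAt (fun s => ∫ r in (0)..s, f r) (f s) s := fun s =>
    (hf.continuous.integral_hasStrictDerivAt 0 s).hasDerivAt
  rw [contDiff_infty_iff_deriv]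
  refine ⟨fun s => (h s).differentiableAt, ?_⟩
  rwa [funext fun s => (h s).deriv]

/-- A closed form of `timeAverage` in which the dependence on `s` is visibly smooth. -/
theorem timeAverage_eq (l h : ℝ) {a : ℝ → ℝ} (ha : Continuous a) (s : ℝ) :
    timeAverage l h a s = Real.exp (l * s) *
      ((∫ r in (0)..(s + h), Real.exp (-(l * r)) * a r) - ∫ r in (0)..s, Real.exp (-(l * r)) * a r) := by
  have hc : Continuous fun r => Real.exp (-(l * r)) * a r := by fun_prop
  rw [intervalIntegral.integral_interval_sub_left (hc.intervalIntegrable _ _)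
    (hc.intervalIntegrable _ _), ← intervalIntegral.integral_const_mul, timeAverage]
  have := intervalIntegral.integral_comp_add_left
    (fun r => Real.exp (l * s) * (Real.exp (-(l * r)) * a r)) (a := 0) (b := h) s
  rw [add_zero] at this
  rw [← this]
  congr 1
  ext r
  rw [← mul_assoc, ← Real.exp_add]
  congr 2; ring

theorem contDiff_timeAverage (l h : ℝ) {a : ℝ → ℝ} (ha : ContDiff ℝ ∞ a) :
    ContDiff ℝ ∞ (timeAverage l h a) := by
  have hc : ContDiff ℝ ∞ fun r => Real.exp (-(l * r)) * a r := by fun_prop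
  rw [funext (timeAverage_eq l h ha.continuous)]
  have h1 := contDiff_integral_of_contDiff hc
  have h2 : ContDiff ℝ ∞ fun s => ∫ r in (0)..(s + h), Real.exp (-(l * r)) * a r :=
    h1.comp (contDiff_id.add contDiff_const)
  exact (by fun_prop : ContDiff ℝ ∞ fun s => Real.exp (l * s)).mul (h2.sub h1)

/-- The backward heat equation `φ_t + Δφ = e^{hΔ} g(·, t + h) - g` for a single mode, whose
eigenvalue for `-Δ` is `l`. -/
theorem deriv_timeAverage (l h : ℝ) {a : ℝ → ℝ} (ha : ContDiff ℝ ∞ a) (s : ℝ) :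
    deriv (timeAverage l h a) s
      = l * timeAverage l h a s + Real.exp (-(l * h)) * a (s + h) - a s := by
  have hc : Continuous fun r => Real.exp (-(l * r)) * a r := by have := ha.continuous; fun_prop
  have h1 := (hc.integral_hasStrictDerivAt 0 s).hasDerivAt
  have h2 := (hc.integral_hasStrictDerivAt 0 (s + h)).hasDerivAt.comp_add_const s h
  have h3 : HasDerivAt (fun s => Real.exp (l * s)) (Real.exp (l * s) * l) s := by
    simpa using ((hasDerivAt_id s).const_mul l).exp
  have h4 := h3.mul (h2.sub h1)
  rw [funext (timeAverage_eq l h ha.continuous)]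
  refine h4.deriv.trans ?_
  have e1 : Real.exp (l * s) * Real.exp (-(l * (s + h))) = Real.exp (-(l * h)) := by
    rw [← Real.exp_add]; congr 1; ring
  have e2 : Real.exp (l * s) * Real.exp (-(l * s)) = 1 := by
    rw [← Real.exp_add]; simp
  simp only [Pi.sub_apply]
  linear_combination a (s + h) * e1 - a s * e2

theorem timeAverage_eq_zero {l h τ : ℝ} (hh : 0 ≤ h) {a : ℝ → ℝ} (ha : ∀ t, τ ≤ t → a t = 0) :
    ∀ s, τ ≤ s → timeAverage l h a s = 0 := by
  intro s hs
  rw [timeAverage, intervalIntegral.integral_congr (g := fun _ => 0)]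
  · simp
  · intro r hr
    rw [Set.uIcc_of_le hh] at hr
    simp [ha (s + r) (by linarith [hr.1])]

theorem volQ_eq_restrict (N : ℕ) (T : ℝ) :
    volQ N T = (volume : Measure (Torus N × ℝ)).restrict (Set.univ ×ˢ Set.Ioo 0 T) := by
  rw [volQ, Measure.volume_eq_prod, ← Measure.prod_restrict, Measure.restrict_univ]

theorem ae_mem_volQ (N : ℕ) (T : ℝ) : ∀ᵐ p ∂volQ N T, p.2 ∈ Set.Ioo 0 T := by
  rw [volQ_eq_restrict]
  filter_upwards [ae_restrict_mem (MeasurableSet.univ.prod measurableSet_Ioo)] with p hp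
  exact hp.2

/-- Continuous functions are bounded on `Q`. -/
theorem exists_bound_volQ (T : ℝ) {f : Torus N × ℝ → ℝ} (hf : Continuous f) :
    ∃ B, ∀ᵐ p ∂volQ N T, ‖f p‖ ≤ B := by
  obtain ⟨B, hB⟩ := (isCompact_univ.prod (isCompact_Icc (a := 0) (b := T))).exists_bound_of_continuousOn
    (f := f) hf.continuousOn
  refine ⟨B, ?_⟩
  filter_upwards [ae_mem_volQ N T] with p hp
  exact hB p ⟨trivial, hp.1.le, hp.2.le⟩

theorem integrable_mul_of_continuous {T : ℝ} {m f : Torus N × ℝ → ℝ}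
    (hm : Integrable m (volQ N T)) (hf : Continuous f) :
    Integrable (fun p => m p * f p) (volQ N T) := by
  obtain ⟨B, hB⟩ := exists_bound_volQ T hf
  exact hm.mul_bdd hf.aestronglyMeasurable hB

/-- The weak formulation tested against `b(t) cos (2πk · x + θ)`. -/
theorem weak_eq_mode {T : ℝ} {m₀ : Torus N → ℝ} {A : Torus N × ℝ → EuclideanSpace ℝ (Fin N)}
    {m : Torus N × ℝ → ℝ} (hw : IsWeakSolution T m₀ A m) {τ : ℝ} (hτ : τ < T) {b : ℝ → ℝ}
    (hb : ContDiff ℝ ∞ b) (hb0 : ∀ t, τ ≤ t → b t = 0) (k : Fin N → ℤ) (θ : ℝ) :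
    ∫ p, m p * ((deriv b p.2 - ‖freq k‖ ^ 2 * b p.2) * tmode k θ p.1
        + b p.2 * tmode k (θ + Real.pi / 2) p.1 * inner ℝ (A p) (freq k)) ∂volQ N T
      + ∫ x, m₀ x * (b 0 * tmode k θ x) = 0 := by
  refine Eq.trans ?_ (hw.weak_eq _ (isTestFunction_mul_tmode hτ hb hb0 k θ))
  congr 2
  ext p
  simp only [torusGradient_mul_tmode, torusLaplacian_mul_tmode, inner_smul_right]
  rw [deriv_mul_const (hb.differentiable (by simp)).differentiableAt]
  ring

theorem exists_lt_forall_eq_zero {T : ℝ} {ψ : ℝ → ℝ} (hc : HasCompactSupport ψ)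
    (hs : tsupport ψ ⊆ Set.Iio T) : ∃ τ < T, ∀ t, τ ≤ t → ψ t = 0 := by
  rcases (tsupport ψ).eq_empty_or_nonempty with h | h
  · refine ⟨T - 1, by linarith, fun t _ => image_eq_zero_of_notMem_tsupport (by simp [h])⟩
  · obtain ⟨M, hM, hmax⟩ := hc.isCompact.exists_isMaxOn h continuousOn_id
    have hMT : M < T := hs hM
    refine ⟨(M + T) / 2, by linarith, fun t ht => image_eq_zero_of_notMem_tsupport fun h' => ?_⟩
    have : t ≤ M := hmax h'
    linarith

/-- A weak solution has unit mass at almost every time: test with functions of time only. -/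
theorem ae_lintegral_eq_one {T : ℝ} {m₀ : Torus N → ℝ} (h₀ : ∫ x, m₀ x = 1)
    {A : Torus N × ℝ → EuclideanSpace ℝ (Fin N)}
    {m : Torus N × ℝ → ℝ} (hw : IsWeakSolution T m₀ A m) (hm : ∀ᵐ p ∂volQ N T, 0 ≤ m p) :
    ∀ᵐ s ∂volume.restrict (Set.Ioo 0 T), ∫⁻ x, ENNReal.ofReal (m (x, s)) = 1 := by
  have hint : Integrable m (volume.prod (volume.restrict (Set.Ioo 0 T))) := hw.integrable
  have hmarg := hint.integral_prod_right
  have hkey : ∀ᵐ s, s ∈ Set.Ioo 0 T → (∫ x, m (x, s)) - 1 = 0 := by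
    refine isOpen_Ioo.ae_eq_zero_of_integral_contDiff_smul_eq_zero ?_ ?_
    · refine IntegrableOn.locallyIntegrableOn ?_
      exact hmarg.sub (integrable_const 1)
    · intro ψ hψ hψc hψs
      obtain ⟨τ, hτ, hψτ⟩ := exists_lt_forall_eq_zero hψc
        (hψs.trans Set.Ioo_subset_Iio_self)
      have hψi : ∀ a b, IntervalIntegrable ψ volume a b :=
        fun a b => hψ.continuous.intervalIntegrable a b
      set b : ℝ → ℝ := fun s => (∫ r in (0)..s, ψ r) - ∫ r in (0)..T, ψ r with hb
      have hbs : ContDiff ℝ ∞ b := (contDiff_integral_of_contDiff hψ).sub contDiff_const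
      have hbd : ∀ s, deriv b s = ψ s := fun s =>
        ((hψ.continuous.integral_hasStrictDerivAt 0 s).hasDerivAt.sub_const _).deriv
      have hb0 : ∀ t, τ ≤ t → b t = 0 := by
        intro t ht
        simp only [hb]
        rw [intervalIntegral.integral_interval_sub_left (hψi _ _) (hψi _ _),
          intervalIntegral.integral_congr (g := fun _ => 0), intervalIntegral.integral_zero]
        intro r hr
        exact hψτ r ((le_min hτ.le ht).trans hr.1)
      have hweak := weak_eq_mode hw hτ hbs hb0 0 0
      have hf0 : freq (0 : Fin N → ℤ) = 0 := by ext i; simp [freq_apply]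
      simp only [hf0, tmode_zero, hbd, norm_zero, inner_zero_right, mul_zero, add_zero, mul_one,
        integral_mul_const, h₀, one_mul] at hweak
      have hbT : b 0 = -∫ s in Set.Ioo 0 T, ψ s := by
        simp only [hb, intervalIntegral.integral_same, zero_sub]
        rcases le_or_gt T 0 with hT | hT
        · have h0 : ∀ s, ψ s = 0 := fun s => by
            by_contra h
            have := hψs (subset_tsupport _ h)
            linarith [this.1, this.2]
          simp [h0]
        · rw [intervalIntegral.integral_of_le hT.le, integral_Ioc_eq_integral_Ioo]
      have hmψ : Integrable (fun p => m p * ψ p.2) (volQ N T) :=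
        integrable_mul_of_continuous hw.integrable (hψ.continuous.comp continuous_snd)
      have hswap : ∫ p, m p * ψ p.2 ∂volQ N T
          = ∫ s in Set.Ioo 0 T, ψ s * ∫ x, m (x, s) := by
        rw [volQ, integral_prod_symm _ hmψ]
        simp only [integral_mul_const, mul_comm (ψ _)]
      have h1 : ∫ s, ψ s • ((∫ x, m (x, s)) - 1)
          = ∫ s in Set.Ioo 0 T, ψ s • ((∫ x, m (x, s)) - 1) := by
        refine (setIntegral_eq_integral_of_forall_compl_eq_zero fun s hs => ?_).symm
        rw [image_eq_zero_of_notMem_tsupport fun h => hs (hψs h), zero_smul]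
      have hψI : IntegrableOn ψ (Set.Ioo 0 T) :=
        (hψ.continuous.integrable_of_hasCompactSupport hψc).integrableOn
      have hψm : IntegrableOn (fun s => ψ s * ∫ x, m (x, s)) (Set.Ioo 0 T) := by
        have := Integrable.integral_prod_right hmψ
        simpa only [IntegrableOn, integral_mul_const, mul_comm (ψ _)] using this
      rw [h1]
      simp only [smul_eq_mul, mul_sub, mul_one]
      rw [integral_sub hψm hψI, ← hswap]
      rw [hbT] at hweak
      simpa [sub_eq_add_neg] using hweak
  have hkey' := (ae_restrict_iff' measurableSet_Ioo).2 hkey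
  have hpos : ∀ᵐ s ∂volume.restrict (Set.Ioo 0 T), ∀ᵐ x : Torus N, 0 ≤ m (x, s) := by
    refine Measure.ae_ae_of_ae_prod (p := fun z : ℝ × Torus N => 0 ≤ m (z.2, z.1)) ?_
    exact (Measure.measurePreserving_swap (μ := volume.restrict (Set.Ioo 0 T))
      (ν := (volume : Measure (Torus N)))).quasiMeasurePreserving.ae hm
  filter_upwards [hkey', hint.prod_left_ae, hpos] with s h1 h2 h3
  rw [← ofReal_integral_eq_lintegral_ofReal h2 h3, sub_eq_zero.1 h1, ENNReal.ofReal_one]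

/-! ### Trigonometric sums and the duality identity -/

/-- The trigonometric polynomial in space with smooth time-dependent coefficients
`∑_j a_j(t) cos (2πk_j · x + θ_j)`. -/
def trigSum (a : Fin n → ℝ → ℝ) (k : Fin n → Fin N → ℤ) (θ : Fin n → ℝ) (p : Torus N × ℝ) : ℝ :=
  ∑ j, a j p.2 * tmode (k j) (θ j) p.1

/-- The heat semigroup for time `h` applied to `trigSum a k θ (·, t + h)`. -/
def trigHeat (h : ℝ) (a : Fin n → ℝ → ℝ) (k : Fin n → Fin N → ℤ) (θ : Fin n → ℝ)
    (p : Torus N × ℝ) : ℝ :=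
  ∑ j, Real.exp (-(‖freq (k j)‖ ^ 2 * h)) * a j (p.2 + h) * tmode (k j) (θ j) p.1

/-- The `i`-th partial derivative of the test function
`φ(·, t) = ∫_0^h e^{rΔ} trigSum a k θ (·, t + r) dr`. -/
def trigGrad (h : ℝ) (a : Fin n → ℝ → ℝ) (k : Fin n → Fin N → ℤ) (θ : Fin n → ℝ) (i : Fin N)
    (p : Torus N × ℝ) : ℝ :=
  ∑ j, timeAverage (‖freq (k j)‖ ^ 2) h (a j) p.2
    * (freq (k j) i * tmode (k j) (θ j + Real.pi / 2) p.1)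

/-- The initial value of the test function
`φ(·, t) = ∫_0^h e^{rΔ} trigSum a k θ (·, t + r) dr`. -/
def trigInit (h : ℝ) (a : Fin n → ℝ → ℝ) (k : Fin n → Fin N → ℤ) (θ : Fin n → ℝ)
    (x : Torus N) : ℝ :=
  ∑ j, timeAverage (‖freq (k j)‖ ^ 2) h (a j) 0 * tmode (k j) (θ j) x

theorem continuous_trigSum {a : Fin n → ℝ → ℝ} (ha : ∀ j, ContDiff ℝ ∞ (a j))
    (k : Fin n → Fin N → ℤ) (θ : Fin n → ℝ) : Continuous (trigSum a k θ) :=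
  continuous_finsetSum _ fun j _ => ((ha j).continuous.comp continuous_snd).mul
    ((continuous_tmode _ _).comp continuous_fst)

theorem continuous_trigGrad (h : ℝ) {a : Fin n → ℝ → ℝ} (ha : ∀ j, ContDiff ℝ ∞ (a j))
    (k : Fin n → Fin N → ℤ) (θ : Fin n → ℝ) (i : Fin N) : Continuous (trigGrad h a k θ i) :=
  continuous_finsetSum _ fun j _ =>
    ((contDiff_timeAverage _ h (ha j)).continuous.comp continuous_snd).mul
      (continuous_const.mul ((continuous_tmode _ _).comp continuous_fst))

/-- The weak formulation, written as a duality identity for `∫ m g` with `g` a trigonometric sum. -/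
theorem integral_mul_trigSum {T : ℝ} {m₀ : Torus N → ℝ} (hm₀ : Integrable m₀)
    {A : Torus N × ℝ → EuclideanSpace ℝ (Fin N)}
    {m : Torus N × ℝ → ℝ} (hw : IsWeakSolution T m₀ A m) {τ : ℝ} (hτ : τ < T) {h : ℝ} (hh : 0 ≤ h)
    {a : Fin n → ℝ → ℝ} (ha : ∀ j, ContDiff ℝ ∞ (a j)) (ha0 : ∀ j t, τ ≤ t → a j t = 0)
    (k : Fin n → Fin N → ℤ) (θ : Fin n → ℝ) :
    ∫ p, m p * trigSum a k θ p ∂volQ N T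
      = ∫ p, m p * trigHeat h a k θ p ∂volQ N T
        + ∑ i, ∫ p, (m p * A p i) * trigGrad h a k θ i p ∂volQ N T
        + ∫ x, m₀ x * trigInit h a k θ x := by
  have hmA : ∀ i, Integrable (fun p => m p * A p i) (volQ N T) := fun i => by
    have := (EuclideanSpace.proj i : EuclideanSpace ℝ (Fin N) →L[ℝ] ℝ).integrable_comp
      hw.integrable_flux
    simpa using this
  have htm : ∀ j (η : ℝ), Continuous fun p : Torus N × ℝ => tmode (k j) η p.1 :=
    fun j η => (continuous_tmode _ _).comp continuous_fst
  have hac : ∀ j, Continuous fun p : Torus N × ℝ => a j p.2 :=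
    fun j => (ha j).continuous.comp continuous_snd
  have hah : ∀ j, Continuous fun p : Torus N × ℝ => a j (p.2 + h) :=
    fun j => (ha j).continuous.comp (continuous_snd.add continuous_const)
  have hta : ∀ j, Continuous fun p : Torus N × ℝ =>
      timeAverage (‖freq (k j)‖ ^ 2) h (a j) p.2 :=
    fun j => (contDiff_timeAverage _ h (ha j)).continuous.comp continuous_snd
  have i1 : ∀ j, Integrable (fun p => m p * (a j p.2 * tmode (k j) (θ j) p.1)) (volQ N T) :=
    fun j => integrable_mul_of_continuous hw.integrable ((hac j).mul (htm j _))
  have i2 : ∀ j, Integrable (fun p => m p * (Real.exp (-(‖freq (k j)‖ ^ 2 * h)) * a j (p.2 + h)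
      * tmode (k j) (θ j) p.1)) (volQ N T) :=
    fun j => integrable_mul_of_continuous hw.integrable
      ((continuous_const.mul (hah j)).mul (htm j _))
  have i3 : ∀ j i, Integrable (fun p => (m p * A p i) * (timeAverage (‖freq (k j)‖ ^ 2) h (a j) p.2
      * (freq (k j) i * tmode (k j) (θ j + Real.pi / 2) p.1))) (volQ N T) :=
    fun j i => integrable_mul_of_continuous (hmA i)
      ((hta j).mul (continuous_const.mul (htm j _)))
  have i4 : ∀ j, Integrable (fun x => m₀ x * (timeAverage (‖freq (k j)‖ ^ 2) h (a j) 0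
      * tmode (k j) (θ j) x)) := fun j => by
    refine hm₀.mul_bdd (c := |timeAverage (‖freq (k j)‖ ^ 2) h (a j) 0|) ?_ (ae_of_all _ fun x => ?_)
    · exact (continuous_const.mul (continuous_tmode _ _)).aestronglyMeasurable
    · rw [norm_mul, Real.norm_eq_abs, Real.norm_eq_abs]
      exact mul_le_of_le_one_right (abs_nonneg _) (abs_tmode_le_one _ _ _)
  simp only [trigSum, trigHeat, trigGrad, trigInit, Finset.mul_sum]
  rw [integral_finsetSum _ fun j _ => i1 j, integral_finsetSum _ fun j _ => i2 j,
    integral_finsetSum _ fun j _ => i4 j]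
  have h3 : ∀ i, ∫ p, ∑ j, (m p * A p i) * (timeAverage (‖freq (k j)‖ ^ 2) h (a j) p.2
      * (freq (k j) i * tmode (k j) (θ j + Real.pi / 2) p.1)) ∂volQ N T
    = ∑ j, ∫ p, (m p * A p i) * (timeAverage (‖freq (k j)‖ ^ 2) h (a j) p.2
      * (freq (k j) i * tmode (k j) (θ j + Real.pi / 2) p.1)) ∂volQ N T :=
    fun i => integral_finsetSum _ fun j _ => i3 j i
  simp only [h3]
  rw [Finset.sum_comm, ← Finset.sum_add_distrib, ← Finset.sum_add_distrib]
  refine Finset.sum_congr rfl fun j _ => ?_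
  have hweak := weak_eq_mode hw hτ (contDiff_timeAverage (‖freq (k j)‖ ^ 2) h (ha j))
    (timeAverage_eq_zero hh (ha0 j)) (k j) (θ j)
  rw [← integral_finsetSum _ fun i _ => i3 j i]
  have i5 := integrable_finsetSum Finset.univ fun i _ => i3 j i
  have h6 : ∀ p, m p * ((deriv (timeAverage (‖freq (k j)‖ ^ 2) h (a j)) p.2
        - ‖freq (k j)‖ ^ 2 * timeAverage (‖freq (k j)‖ ^ 2) h (a j) p.2) * tmode (k j) (θ j) p.1
        + timeAverage (‖freq (k j)‖ ^ 2) h (a j) p.2 * tmode (k j) (θ j + Real.pi / 2) p.1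
          * inner ℝ (A p) (freq (k j)))
      = m p * (Real.exp (-(‖freq (k j)‖ ^ 2 * h)) * a j (p.2 + h) * tmode (k j) (θ j) p.1)
        + ∑ i, (m p * A p i) * (timeAverage (‖freq (k j)‖ ^ 2) h (a j) p.2
          * (freq (k j) i * tmode (k j) (θ j + Real.pi / 2) p.1))
        - m p * (a j p.2 * tmode (k j) (θ j) p.1) := by
    intro p
    rw [deriv_timeAverage _ _ (ha j), PiLp.inner_apply, mul_add, Finset.mul_sum, Finset.mul_sum]
    have : ∀ i, m p * (timeAverage (‖freq (k j)‖ ^ 2) h (a j) p.2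
          * tmode (k j) (θ j + Real.pi / 2) p.1 * inner ℝ (A p i) (freq (k j) i))
        = (m p * A p i) * (timeAverage (‖freq (k j)‖ ^ 2) h (a j) p.2
          * (freq (k j) i * tmode (k j) (θ j + Real.pi / 2) p.1)) := fun i => by
      simp only [RCLike.inner_apply, conj_trivial]; ring
    simp only [this]
    ring
  simp only [h6] at hweak
  have h7 := integral_sub ((i2 j).add i5) (i1 j)
  have h8 := integral_add (i2 j) i5
  simp only [Pi.add_apply] at h7
  linarith

/-- The heat semigroup on trigonometric sums as a Gaussian average. -/
theorem trigHeat_eq {h : ℝ} (hh : 0 ≤ h) (a : Fin n → ℝ → ℝ)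
    (k : Fin n → Fin N → ℤ) (θ : Fin n → ℝ) (p : Torus N × ℝ) :
    trigHeat h a k θ p = ∫ z, trigSum a k θ (p.1 + heatShift h z, p.2 + h) ∂gauss N := by
  simp only [trigSum, trigHeat]
  rw [integral_finsetSum]
  · refine Finset.sum_congr rfl fun j _ => ?_
    rw [integral_const_mul, integral_tmode_heatShift _ _ hh]
    ring
  · intro j _
    refine Integrable.const_mul ?_ _
    refine (integrable_const (1 : ℝ)).mono' ?_ (ae_of_all _ fun z => abs_tmode_le_one _ _ _)
    exact ((continuous_tmode _ _).measurable.comp (measurable_const.add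
      (measurable_heatShift.comp (measurable_const.prodMk measurable_id)))).aestronglyMeasurable

theorem integrable_mul_tmode_heatShift (k : Fin N → ℤ) (θ r : ℝ) (x : Torus N) (i : Fin N) :
    Integrable (fun z => z i * tmode k θ (x + heatShift r z)) (gauss N) := by
  have hz : Integrable (fun z : Fin N → ℝ => z i) (gauss N) :=
    (integrable_comp_eval (μ := fun _ => ProbabilityTheory.gaussianReal 0 1) (i := i)
      (f := fun x : ℝ => x)
      ((ProbabilityTheory.memLp_id_gaussianReal (μ := 0) (v := 1) 1).integrable le_rfl))
  refine hz.mul_bdd (c := 1) ?_ (ae_of_all _ fun z => abs_tmode_le_one _ _ _)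
  exact ((continuous_tmode _ _).measurable.comp (measurable_const.add
      (measurable_heatShift.comp (measurable_const.prodMk measurable_id)))).aestronglyMeasurable

/-- The gradient of the test function as an average of `g` itself, of total weight `O(√h)`. -/
theorem trigGrad_eq {h : ℝ} (hh : 0 ≤ h) {a : Fin n → ℝ → ℝ} (ha : ∀ j, ContDiff ℝ ∞ (a j))
    (k : Fin n → Fin N → ℤ) (θ : Fin n → ℝ) (i : Fin N) (p : Torus N × ℝ) :
    trigGrad h a k θ i p = ∫ r in Set.Ioc 0 h, (√(2 * r))⁻¹ *
      ∫ z, z i * trigSum a k θ (p.1 + heatShift r z, p.2 + r) ∂gauss N := by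
  have hac := fun j => (ha j).continuous
  simp only [trigGrad, timeAverage, ← intervalIntegral.integral_mul_const]
  rw [← intervalIntegral.integral_finsetSum, intervalIntegral.integral_of_le hh]
  · refine setIntegral_congr_fun measurableSet_Ioc fun r hr => ?_
    simp only [trigSum, Finset.mul_sum]
    rw [integral_finsetSum, Finset.mul_sum]
    · refine Finset.sum_congr rfl fun j _ => ?_
      simp only [mul_left_comm _ (a j _)]
      rw [integral_const_mul, integral_mul_tmode_heatShift _ _ hr.1.le]
      have : √(2 * r) ≠ 0 := (Real.sqrt_pos.2 (by linarith [hr.1])).ne'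
      rw [inv_mul_eq_div, mul_div_assoc, mul_div_cancel_left₀ _ this]
      ring
    · intro j _
      simp only [mul_left_comm _ (a j _)]
      exact (integrable_mul_tmode_heatShift _ _ _ _ _).const_mul _
  · intro j _
    refine Continuous.intervalIntegrable ?_ _ _
    have := hac j
    fun_prop

theorem trigInit_eq {h : ℝ} (hh : 0 ≤ h) {a : Fin n → ℝ → ℝ} (ha : ∀ j, ContDiff ℝ ∞ (a j))
    (k : Fin n → Fin N → ℤ) (θ : Fin n → ℝ) (x : Torus N) :
    trigInit h a k θ x = ∫ r in Set.Ioc 0 h,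
      ∫ z, trigSum a k θ (x + heatShift r z, r) ∂gauss N := by
  have hac := fun j => (ha j).continuous
  simp only [trigInit, timeAverage, ← intervalIntegral.integral_mul_const]
  rw [← intervalIntegral.integral_finsetSum, intervalIntegral.integral_of_le hh]
  · refine setIntegral_congr_fun measurableSet_Ioc fun r hr => ?_
    have := trigHeat_eq hr.1.le a k θ (x, 0)
    simpa [trigHeat] using this
  · intro j _
    refine Continuous.intervalIntegrable ?_ _ _
    have := hac j
    fun_prop

/-! ### Averages of translates on `Q` -/

instance : (volume : Measure (Torus N)).IsAddRightInvariant :=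
  inferInstanceAs (Measure.pi fun _ : Fin N => (volume : Measure UnitAddCircle)).IsAddRightInvariant

/-- A forward shift in time pushes mass out of `(0, T)` only through `T`, beyond which `f` is zero. -/
theorem setLIntegral_shift_le {T h : ℝ} (hh : 0 ≤ h) {f : ℝ → ℝ≥0∞} (hf : ∀ t, T ≤ t → f t = 0) :
    ∫⁻ s in Set.Ioo 0 T, f (s + h) ≤ ∫⁻ s in Set.Ioo 0 T, f s := by
  rw [← lintegral_indicator measurableSet_Ioo, ← lintegral_indicator measurableSet_Ioo,
    ← lintegral_add_right_eq_self ((Set.Ioo 0 T).indicator f) h]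
  refine lintegral_mono fun s => ?_
  by_cases hs : s ∈ Set.Ioo 0 T
  · rw [Set.indicator_of_mem hs]
    rcases lt_or_ge (s + h) T with h1 | h1
    · have : s + h ∈ Set.Ioo 0 T := ⟨by linarith [hs.1], h1⟩
      rw [Set.indicator_of_mem this]
    · rw [hf _ h1]; exact zero_le
  · rw [Set.indicator_of_notMem hs]; exact zero_le

theorem lintegral_volQ {T : ℝ} {f : Torus N × ℝ → ℝ≥0∞} (hf : AEMeasurable f (volQ N T)) :
    ∫⁻ p, f p ∂volQ N T = ∫⁻ s in Set.Ioo 0 T, ∫⁻ x, f (x, s) :=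
  lintegral_prod_symm _ hf

/-- Translations forward in time do not increase integrals over `Q` of functions vanishing after
time `T`. -/
theorem lintegral_volQ_translate_le {T h : ℝ} (hh : 0 ≤ h) (y : Torus N)
    {f : Torus N × ℝ → ℝ≥0∞} (hf : Measurable f) (h0 : ∀ x t, T ≤ t → f (x, t) = 0) :
    ∫⁻ p, f (p.1 + y, p.2 + h) ∂volQ N T ≤ ∫⁻ p, f p ∂volQ N T := by
  rw [lintegral_volQ (by fun_prop), lintegral_volQ hf.aemeasurable]
  have : ∀ s, ∫⁻ x, f (x + y, s + h) = ∫⁻ x, f (x, s + h) := fun s =>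
    lintegral_add_right_eq_self (fun x => f (x, s + h)) y
  simp only [this]
  refine setLIntegral_shift_le (f := fun s => ∫⁻ x, f (x, s)) hh fun t ht => ?_
  simp [h0 _ t ht]

/-- Jensen's inequality for powers, with respect to a measure of arbitrary total mass. -/
theorem lintegral_rpow_le {Y : Type*} [MeasurableSpace Y] (ρ : Measure Y) {s : ℝ} (hs : 1 < s)
    {f : Y → ℝ≥0∞} (hf : AEMeasurable f ρ) :
    (∫⁻ y, f y ∂ρ) ^ s ≤ ρ Set.univ ^ (s - 1) * ∫⁻ y, f y ^ s ∂ρ := by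
  have hc := Real.HolderConjugate.conjExponent hs
  have h1 := ENNReal.lintegral_mul_le_Lp_mul_Lq ρ hc hf (aemeasurable_const (b := (1 : ℝ≥0∞)))
  simp only [Pi.mul_apply, mul_one, ENNReal.one_rpow, lintegral_const, one_mul] at h1
  refine (ENNReal.rpow_le_rpow h1 hc.nonneg).trans ?_
  rw [ENNReal.mul_rpow_of_nonneg _ _ hc.nonneg, ← ENNReal.rpow_mul, ← ENNReal.rpow_mul,
    one_div_mul_cancel hc.ne_zero, ENNReal.rpow_one, mul_comm]
  have : 1 / Real.conjExponent s * s = s - 1 := by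
    have h1 : s - 1 ≠ 0 := by linarith
    rw [Real.conjExponent]; field_simp
  rw [this]

/-- Young's inequality for averages of forward translates. -/
theorem lintegral_average_rpow_le {T s : ℝ} (hs : 1 < s) (ρ : Measure (ℝ × (Fin N → ℝ))) [SFinite ρ]
    (hρ : ∀ᵐ y ∂ρ, 0 ≤ y.1) (hfin : ρ Set.univ ≠ ⊤)
    {f : Torus N × ℝ → ℝ≥0∞} (hf : Measurable f) (h0 : ∀ x t, T ≤ t → f (x, t) = 0) :
    ∫⁻ p, (∫⁻ y, f (p.1 + heatShift y.1 y.2, p.2 + y.1) ∂ρ) ^ s ∂volQ N T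
      ≤ ρ Set.univ ^ s * ∫⁻ p, f p ^ s ∂volQ N T := by
  have hs0 : 0 < s := by linarith
  have hsh : Measurable fun q : (Torus N × ℝ) × (ℝ × (Fin N → ℝ)) =>
      f (q.1.1 + heatShift q.2.1 q.2.2, q.1.2 + q.2.1) := by
    refine hf.comp (Measurable.prodMk ?_ ?_)
    · exact measurable_fst.fst.add (measurable_heatShift.comp measurable_snd)
    · exact measurable_fst.snd.add measurable_snd.fst
  calc ∫⁻ p, (∫⁻ y, f (p.1 + heatShift y.1 y.2, p.2 + y.1) ∂ρ) ^ s ∂volQ N T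
      ≤ ∫⁻ p, ρ Set.univ ^ (s - 1)
          * ∫⁻ y, f (p.1 + heatShift y.1 y.2, p.2 + y.1) ^ s ∂ρ ∂volQ N T :=
        lintegral_mono fun p => lintegral_rpow_le ρ hs
          (hsh.comp (measurable_const.prodMk measurable_id)).aemeasurable
    _ = ρ Set.univ ^ (s - 1) *
          ∫⁻ y, ∫⁻ p, f (p.1 + heatShift y.1 y.2, p.2 + y.1) ^ s ∂volQ N T ∂ρ := by
        rw [lintegral_const_mul' _ _ (ENNReal.rpow_ne_top_of_nonneg (by linarith) hfin),
          lintegral_lintegral_swap]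
        exact (hsh.pow_const s).aemeasurable
    _ ≤ ρ Set.univ ^ (s - 1) * ∫⁻ _, ∫⁻ p, f p ^ s ∂volQ N T ∂ρ := by
        refine mul_le_mul_right (lintegral_mono_ae (hρ.mono fun y hy => ?_)) _
        refine lintegral_volQ_translate_le (f := fun p => f p ^ s) hy _ (hf.pow_const s) ?_
        intro x t ht
        simp [h0 x t ht, hs0]
    _ = ρ Set.univ ^ s * ∫⁻ p, f p ^ s ∂volQ N T := by
        have h1 : ρ Set.univ ^ s = ρ Set.univ ^ (s - 1) * ρ Set.univ := by
          conv_lhs => rw [← sub_add_cancel s 1,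
            ENNReal.rpow_add_of_nonneg _ _ (by linarith) zero_le_one, ENNReal.rpow_one]
        rw [lintegral_const, h1]
        ring

/-- The weight `(2r)^{-1/2} |z_i|` of Gaussian integration by parts. -/
def gradMeasure (h : ℝ) (i : Fin N) : Measure (ℝ × (Fin N → ℝ)) :=
  ((volume.restrict (Set.Ioc 0 h)).prod (gauss N)).withDensity
    fun y => ENNReal.ofReal (√(2 * y.1))⁻¹ * ‖y.2 i‖ₑ

instance (h : ℝ) (i : Fin N) : SFinite (gradMeasure h i) := by unfold gradMeasure; infer_instance

theorem lintegral_inv_sqrt {h : ℝ} (hh : 0 ≤ h) :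
    ∫⁻ r in Set.Ioc 0 h, ENNReal.ofReal (√(2 * r))⁻¹ = ENNReal.ofReal (√2 * √h) := by
  have h1 : ∀ r : ℝ, r ∈ Set.Ioc 0 h → (√(2 * r))⁻¹ = (√2)⁻¹ * r ^ (-(1 / 2) : ℝ) := by
    intro r hr
    rw [Real.sqrt_mul zero_le_two, mul_inv, Real.rpow_neg hr.1.le, Real.sqrt_eq_rpow r]
  have h2 : IntegrableOn (fun r : ℝ => (√2)⁻¹ * r ^ (-(1 / 2) : ℝ)) (Set.Ioc 0 h) := by
    rw [← intervalIntegrable_iff_integrableOn_Ioc_of_le hh]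
    exact (intervalIntegral.intervalIntegrable_rpow' (by norm_num)).const_mul _
  rw [setLIntegral_congr_fun measurableSet_Ioc fun r hr => by rw [h1 r hr],
    ← ofReal_integral_eq_lintegral_ofReal h2]
  · congr 1
    rw [← intervalIntegral.integral_of_le hh, intervalIntegral.integral_const_mul,
      integral_rpow (Or.inl (by norm_num))]
    norm_num
    rw [← Real.sqrt_eq_rpow h]
    have h3 : √2 * √2 = (2 : ℝ) := Real.mul_self_sqrt zero_le_two
    field_simp
    rw [sq, h3, mul_comm]
  · filter_upwards [ae_restrict_mem measurableSet_Ioc] with r hr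
    have := hr.1
    positivity

/-- The absolute first moment of the standard Gaussian. -/
def gaussMoment : ℝ≥0∞ := ∫⁻ z, ‖z‖ₑ ∂ProbabilityTheory.gaussianReal 0 1

theorem lintegral_enorm_eval_gauss (i : Fin N) :
    ∫⁻ z, ‖z i‖ₑ ∂gauss N = gaussMoment := by
  have h := measurePreserving_eval (fun _ : Fin N => ProbabilityTheory.gaussianReal 0 1) i
  exact h.lintegral_comp (f := fun z : ℝ => ‖z‖ₑ) measurable_enorm

theorem gaussMoment_ne_top : gaussMoment ≠ ⊤ :=
  ((ProbabilityTheory.memLp_id_gaussianReal (μ := 0) (v := 1) 1).integrable le_rfl).2.ne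

theorem gradMeasure_univ {h : ℝ} (hh : 0 ≤ h) (i : Fin N) :
    gradMeasure h i Set.univ
      = ENNReal.ofReal (√2 * √h) * gaussMoment := by
  rw [gradMeasure, withDensity_apply _ MeasurableSet.univ, Measure.restrict_univ,
    lintegral_prod_mul (f := fun r => ENNReal.ofReal (√(2 * r))⁻¹)
      (g := fun z : Fin N → ℝ => ‖z i‖ₑ) (by fun_prop) (measurable_pi_apply i).enorm.aemeasurable,
    lintegral_inv_sqrt hh, lintegral_enorm_eval_gauss]

/-! ### Estimates for the test function -/

section Estimates

variable {T τ h : ℝ} {a : Fin n → ℝ → ℝ} {k : Fin n → Fin N → ℤ} {θ : Fin n → ℝ}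

theorem trigSum_eq_zero (hτ : τ < T) (ha0 : ∀ j t, τ ≤ t → a j t = 0) (x : Torus N) (t : ℝ)
    (ht : T ≤ t) : trigSum a k θ (x, t) = 0 :=
  Finset.sum_eq_zero fun j _ => by simp [ha0 j t (hτ.le.trans ht)]

theorem measurable_heatShift_right (r : ℝ) : Measurable (heatShift r : (Fin N → ℝ) → Torus N) :=
  measurable_heatShift.comp (measurable_const.prodMk measurable_id)

theorem enorm_trigHeat_le (ha : ∀ j, ContDiff ℝ ∞ (a j)) (hh : 0 ≤ h) {c : ℝ≥0∞}
    (hc : (gauss N).map (heatShift h) ≤ c • (volume : Measure (Torus N))) (p : Torus N × ℝ) :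
    ‖trigHeat h a k θ p‖ₑ ≤ c * ∫⁻ y, ‖trigSum a k θ (y, p.2 + h)‖ₑ := by
  have hm : Measurable fun x => ‖trigSum a k θ x‖ₑ := (continuous_trigSum ha k θ).measurable.enorm
  rw [trigHeat_eq hh]
  refine (enorm_integral_le_lintegral_enorm _).trans ?_
  have hm' : Measurable fun y : Torus N => ‖trigSum a k θ (p.1 + y, p.2 + h)‖ₑ :=
    hm.comp (by fun_prop)
  rw [← lintegral_map hm' (measurable_heatShift_right h)]
  refine (lintegral_mono' hc le_rfl).trans ?_
  rw [lintegral_smul_measure, smul_eq_mul]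
  simp only [add_comm p.1]
  rw [lintegral_add_right_eq_self (fun y => ‖trigSum a k θ (y, p.2 + h)‖ₑ) p.1]

theorem lintegral_trigSum_eq_zero (hτ : τ < T) (ha0 : ∀ j t, τ ≤ t → a j t = 0) (t : ℝ)
    (ht : T ≤ t) : ∫⁻ y, ‖trigSum a k θ (y, t)‖ₑ = 0 := by
  simp [trigSum_eq_zero hτ ha0 _ t ht]

/-- The contribution of the heat flow over the time step `h`: mass one of the solution and the
sup bound for the heat kernel. -/
theorem lintegral_mul_trigHeat_le (hτ : τ < T) (ha : ∀ j, ContDiff ℝ ∞ (a j))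
    (ha0 : ∀ j t, τ ≤ t → a j t = 0) (hh : 0 ≤ h) {c : ℝ≥0∞}
    (hc : (gauss N).map (heatShift h) ≤ c • (volume : Measure (Torus N)))
    {μ : Torus N × ℝ → ℝ≥0∞} (hμ : AEMeasurable μ (volQ N T))
    (hμ1 : ∀ᵐ s ∂volume.restrict (Set.Ioo 0 T), ∫⁻ x, μ (x, s) = 1) :
    ∫⁻ p, μ p * ‖trigHeat h a k θ p‖ₑ ∂volQ N T ≤ c * ∫⁻ p, ‖trigSum a k θ p‖ₑ ∂volQ N T := by
  have hm : Measurable fun x => ‖trigSum a k θ x‖ₑ := (continuous_trigSum ha k θ).measurable.enorm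
  have hW : Measurable fun t => ∫⁻ y, ‖trigSum a k θ (y, t)‖ₑ := hm.lintegral_prod_left'
  have hW' : Measurable fun p : Torus N × ℝ => ∫⁻ y, ‖trigSum a k θ (y, p.2 + h)‖ₑ :=
    hW.comp (by fun_prop)
  calc ∫⁻ p, μ p * ‖trigHeat h a k θ p‖ₑ ∂volQ N T
      ≤ ∫⁻ p, μ p * (c * ∫⁻ y, ‖trigSum a k θ (y, p.2 + h)‖ₑ) ∂volQ N T :=
        lintegral_mono fun p => by gcongr; exact enorm_trigHeat_le ha hh hc p
    _ = ∫⁻ s in Set.Ioo 0 T, c * ∫⁻ y, ‖trigSum a k θ (y, s + h)‖ₑ := by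
        refine (lintegral_volQ (hμ.mul (hW'.const_mul c).aemeasurable)).trans ?_
        simp only [Pi.mul_apply]
        have hsec : ∀ᵐ s ∂volume.restrict (Set.Ioo 0 T), AEMeasurable (fun x => μ (x, s)) := by
          have : AEMeasurable (fun q : ℝ × Torus N => μ q.swap)
              ((volume.restrict (Set.Ioo 0 T)).prod volume) := hμ.comp_quasiMeasurePreserving
            Measure.measurePreserving_swap.quasiMeasurePreserving
          filter_upwards [this.aestronglyMeasurable.prodMk_left] with s hs using hs.aemeasurable
        refine lintegral_congr_ae ?_
        filter_upwards [hμ1, hsec] with s h1 h2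
        rw [lintegral_mul_const'' _ h2, h1, one_mul]
    _ ≤ ∫⁻ s in Set.Ioo 0 T, c * ∫⁻ y, ‖trigSum a k θ (y, s)‖ₑ :=
        setLIntegral_shift_le (f := fun s => c * ∫⁻ y, ‖trigSum a k θ (y, s)‖ₑ) hh fun t ht => by
          rw [lintegral_trigSum_eq_zero hτ ha0 t ht, mul_zero]
    _ = c * ∫⁻ p, ‖trigSum a k θ p‖ₑ ∂volQ N T := by
        rw [lintegral_volQ hm.aemeasurable, lintegral_const_mul _ hW]

/-- The initial value of the test function is bounded in `L^1` by `g`, as the heat semigroup is a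
contraction there. -/
theorem lintegral_trigInit_le (hτ : τ < T) (ha : ∀ j, ContDiff ℝ ∞ (a j))
    (ha0 : ∀ j t, τ ≤ t → a j t = 0) (hh : 0 ≤ h) :
    ∫⁻ x, ‖trigInit h a k θ x‖ₑ ≤ ∫⁻ p, ‖trigSum a k θ p‖ₑ ∂volQ N T := by
  have hm : Measurable fun x => ‖trigSum a k θ x‖ₑ := (continuous_trigSum ha k θ).measurable.enorm
  have hsh : Measurable fun q : Torus N × (ℝ × (Fin N → ℝ)) =>
      ‖trigSum a k θ (q.1 + heatShift q.2.1 q.2.2, q.2.1)‖ₑ := by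
    refine hm.comp (Measurable.prodMk ?_ measurable_snd.fst)
    exact measurable_fst.add (measurable_heatShift.comp measurable_snd)
  calc ∫⁻ x, ‖trigInit h a k θ x‖ₑ
      ≤ ∫⁻ x, ∫⁻ r in Set.Ioc 0 h, ∫⁻ z, ‖trigSum a k θ (x + heatShift r z, r)‖ₑ ∂gauss N := by
        refine lintegral_mono fun x => ?_
        rw [trigInit_eq hh ha]
        refine (enorm_integral_le_lintegral_enorm _).trans (lintegral_mono fun r => ?_)
        exact enorm_integral_le_lintegral_enorm _
    _ = ∫⁻ x, ∫⁻ y, ‖trigSum a k θ (x + heatShift y.1 y.2, y.1)‖ₑ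
          ∂(volume.restrict (Set.Ioc 0 h)).prod (gauss N) := by
        refine lintegral_congr fun x => ?_
        rw [lintegral_prod]
        exact (hsh.comp (measurable_const.prodMk measurable_id)).aemeasurable
    _ = ∫⁻ y, ∫⁻ x : Torus N, ‖trigSum a k θ (x + heatShift y.1 y.2, y.1)‖ₑ ∂volume
          ∂(volume.restrict (Set.Ioc 0 h)).prod (gauss N) :=
        lintegral_lintegral_swap hsh.aemeasurable
    _ = ∫⁻ y, ∫⁻ x : Torus N, ‖trigSum a k θ (x, y.1)‖ₑ ∂volume
          ∂(volume.restrict (Set.Ioc 0 h)).prod (gauss N) := by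
        refine lintegral_congr fun y => ?_
        exact lintegral_add_right_eq_self (fun x => ‖trigSum a k θ (x, y.1)‖ₑ) _
    _ = ∫⁻ r in Set.Ioc 0 h, ∫⁻ x, ‖trigSum a k θ (x, r)‖ₑ := by
        have hW : Measurable fun t => ∫⁻ y, ‖trigSum a k θ (y, t)‖ₑ := hm.lintegral_prod_left'
        refine (lintegral_prod _ (hW.comp measurable_fst).aemeasurable).trans ?_
        simp
    _ ≤ ∫⁻ p, ‖trigSum a k θ p‖ₑ ∂volQ N T := by
        rw [lintegral_volQ hm.aemeasurable, ← lintegral_indicator measurableSet_Ioc,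
          ← lintegral_indicator measurableSet_Ioo]
        refine lintegral_mono fun r => ?_
        by_cases hr : r ∈ Set.Ioc 0 h
        · rw [Set.indicator_of_mem hr]
          rcases lt_or_ge r T with h1 | h1
          · have : r ∈ Set.Ioo 0 T := ⟨hr.1, h1⟩
            rw [Set.indicator_of_mem this]
          · rw [lintegral_trigSum_eq_zero hτ ha0 r h1]; exact zero_le
        · rw [Set.indicator_of_notMem hr]; exact zero_le

/-- The gain of one derivative: `‖∂_i φ‖_{L^s(Q)} ≤ C √h ‖g‖_{L^s(Q)}`. -/
theorem lintegral_trigGrad_rpow_le (hτ : τ < T) (ha : ∀ j, ContDiff ℝ ∞ (a j))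
    (ha0 : ∀ j t, τ ≤ t → a j t = 0) (hh : 0 ≤ h) {s : ℝ} (hs : 1 < s) (i : Fin N) :
    ∫⁻ p, ‖trigGrad h a k θ i p‖ₑ ^ s ∂volQ N T
      ≤ (ENNReal.ofReal (√2 * √h) * gaussMoment) ^ s
        * ∫⁻ p, ‖trigSum a k θ p‖ₑ ^ s ∂volQ N T := by
  have hm : Measurable fun x => ‖trigSum a k θ x‖ₑ := (continuous_trigSum ha k θ).measurable.enorm
  have hw : Measurable fun y : ℝ × (Fin N → ℝ) => ENNReal.ofReal (√(2 * y.1))⁻¹ * ‖y.2 i‖ₑ := by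
    refine Measurable.mul (f := fun y : ℝ × (Fin N → ℝ) => ENNReal.ofReal (√(2 * y.1))⁻¹)
      (by fun_prop) ?_
    exact ((measurable_pi_apply i).comp measurable_snd).enorm
  rw [← gradMeasure_univ hh i]
  refine le_trans (lintegral_mono fun p => ?_) (lintegral_average_rpow_le hs (gradMeasure h i) ?_ ?_
    hm fun x t ht => by simp [trigSum_eq_zero hτ ha0 x t ht])
  · refine ENNReal.rpow_le_rpow ?_ (by linarith)
    have hsh : Measurable fun q : ℝ × (Fin N → ℝ) =>
        ‖trigSum a k θ (p.1 + heatShift q.1 q.2, p.2 + q.1)‖ₑ :=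
      hm.comp (Measurable.prodMk (measurable_const.add measurable_heatShift) (by fun_prop))
    rw [gradMeasure, lintegral_withDensity_eq_lintegral_mul _ hw hsh,
      lintegral_prod _ (hw.mul hsh).aemeasurable, trigGrad_eq hh ha]
    refine (enorm_integral_le_lintegral_enorm _).trans (lintegral_mono fun r => ?_)
    rw [enorm_mul, Real.enorm_of_nonneg (by positivity)]
    simp only [Pi.mul_apply, mul_assoc]
    rw [lintegral_const_mul' _ _ ENNReal.ofReal_ne_top]
    gcongr
    refine (enorm_integral_le_lintegral_enorm _).trans_eq ?_
    simp only [enorm_mul]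
  · rw [gradMeasure]
    refine withDensity_absolutelyContinuous _ _ |>.ae_le ?_
    have : ∀ᵐ r ∂volume.restrict (Set.Ioc 0 h), 0 ≤ r := by
      filter_upwards [ae_restrict_mem measurableSet_Ioc] with r hr using hr.1.le
    exact Measure.quasiMeasurePreserving_fst.ae this
  · rw [gradMeasure_univ hh]
    exact ENNReal.mul_ne_top ENNReal.ofReal_ne_top gaussMoment_ne_top

end Estimates

/-- Hölder's inequality for the flux: `∫ m |A| ψ ≤ E^{1/γ'} M^{1/(pγ)} ‖ψ‖_{γp'}`, with
`E = ∫ |A|^{γ'} m` and `M = ∫ m^p`. -/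
theorem lintegral_flux_le {X : Type*} [MeasurableSpace X] {ν : Measure X} {γ' γ p p' : ℝ}
    (hγ : γ'.HolderConjugate γ) (hp : p.HolderConjugate p') {μ B ψ : X → ℝ≥0∞}
    (hμ : AEMeasurable μ ν) (hB : AEMeasurable B ν) (hψ : AEMeasurable ψ ν) :
    ∫⁻ x, μ x * B x * ψ x ∂ν ≤ (∫⁻ x, B x ^ γ' * μ x ∂ν) ^ (1 / γ')
      * (∫⁻ x, μ x ^ p ∂ν) ^ (1 / (p * γ)) * (∫⁻ x, ψ x ^ (γ * p') ∂ν) ^ (1 / (γ * p')) := by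
  have hγ0 := hγ.symm.nonneg
  have h1 : ∀ x, μ x * B x * ψ x
      = ((fun x => B x * μ x ^ (1 / γ')) * fun x => μ x ^ (1 / γ) * ψ x) x := by
    intro x
    have : μ x = μ x ^ (1 / γ') * μ x ^ (1 / γ) := by
      rw [← ENNReal.rpow_add_of_nonneg _ _ hγ.one_div_nonneg hγ.symm.one_div_nonneg, one_div, one_div,
        hγ.inv_add_inv_eq_one, ENNReal.rpow_one]
    simp only [Pi.mul_apply]
    nth_rewrite 1 [this]
    ring
  simp only [h1]
  refine (ENNReal.lintegral_mul_le_Lp_mul_Lq ν hγ (hB.mul (hμ.pow_const _))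
    ((hμ.pow_const _).mul hψ)).trans ?_
  rw [mul_assoc]
  refine mul_le_mul' (ENNReal.rpow_le_rpow (lintegral_mono fun x => ?_) hγ.one_div_nonneg) ?_
  · rw [Pi.mul_apply, ENNReal.mul_rpow_of_nonneg _ _ hγ.nonneg, ← ENNReal.rpow_mul,
      one_div_mul_cancel hγ.ne_zero, ENNReal.rpow_one]
  · have h2 : ∀ x, (μ x ^ (1 / γ) * ψ x) ^ γ = (μ * fun x => ψ x ^ γ) x := fun x => by
      rw [ENNReal.mul_rpow_of_nonneg _ _ hγ0, ← ENNReal.rpow_mul,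
        one_div_mul_cancel hγ.symm.ne_zero, ENNReal.rpow_one, Pi.mul_apply]
    refine (ENNReal.rpow_le_rpow (lintegral_congr h2).le hγ.symm.one_div_nonneg).trans ?_
    refine (ENNReal.rpow_le_rpow (ENNReal.lintegral_mul_le_Lp_mul_Lq ν hp hμ (hψ.pow_const _))
      hγ.symm.one_div_nonneg).trans_eq ?_
    rw [ENNReal.mul_rpow_of_nonneg _ _ hγ.symm.one_div_nonneg, ← ENNReal.rpow_mul,
      ← ENNReal.rpow_mul]
    simp only [← ENNReal.rpow_mul]
    congr 2
    · rw [one_div_mul_one_div]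
    · rw [one_div_mul_one_div, mul_comm]

/-! ### Bounded data and density of trigonometric sums -/

/-- A density with gradient bounded by `K` is bounded by `1 + K √N`: it takes a value at most `1`,
and any two points of the torus are at distance at most `√N`. -/
theorem le_of_norm_torusGradient_le {m₀ : Torus N → ℝ} {K : ℝ} (hm₀ : TorusContDiff 2 m₀)
    (h1 : ∫ x, m₀ x = 1) (hK : ∀ x, ‖torusGradient m₀ x‖ ≤ K) (x : Torus N) :
    m₀ x ≤ 1 + K * √N := by
  -- A non-integrable density would have integral zero.
  have hint : Integrable m₀ := by
    by_contra h
    rw [integral_undef h] at h1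
    exact zero_ne_one h1
  obtain ⟨x₀, hx₀⟩ := exists_le_integral hint
  rw [h1] at hx₀
  have hK0 : 0 ≤ K := (norm_nonneg _).trans (hK x)
  set f : EuclideanSpace ℝ (Fin N) → ℝ := fun v => m₀ (proj v) with hf
  have hfd : Differentiable ℝ f := hm₀.differentiable (by norm_num)
  have hfK : ∀ v, ‖fderiv ℝ f v‖ ≤ K := by
    intro w
    have h2 : torusGradient m₀ (proj w) = gradient (fun v => f (w + v)) 0 := by
      rw [torusGradient]
      ext v
      simp only [hf]
      rfl
    have := hK (proj w)
    rw [h2, gradient, LinearIsometryEquiv.norm_map, fderiv_comp_add_left, add_zero] at this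
    exact this
  obtain ⟨w₀, rfl⟩ := tproj_surjective x₀
  obtain ⟨w, rfl⟩ := tproj_surjective x
  -- A representative of `x` in the unit cell based at `w₀`.
  set w' : Fin N → ℝ := fun i => w i - ⌊w i - w₀ i⌋ with hw'
  have hww : tproj w = tproj w' := by
    ext i
    simp only [tproj, hw']
    rw [AddCircle.coe_sub, eq_comm, sub_eq_self, AddCircle.coe_eq_zero_iff]
    exact ⟨⌊w i - w₀ i⌋, by simp⟩
  have hdist : ‖(WithLp.toLp 2 w' : EuclideanSpace ℝ (Fin N)) - WithLp.toLp 2 w₀‖ ≤ √N := by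
    rw [EuclideanSpace.norm_eq]
    refine Real.sqrt_le_sqrt ?_
    calc ∑ i, ‖((WithLp.toLp 2 w' : EuclideanSpace ℝ (Fin N)) - WithLp.toLp 2 w₀) i‖ ^ 2
        ≤ ∑ _i : Fin N, (1 : ℝ) := by
          refine Finset.sum_le_sum fun i _ => ?_
          have e : ((WithLp.toLp 2 w' : EuclideanSpace ℝ (Fin N)) - WithLp.toLp 2 w₀) i
              = Int.fract (w i - w₀ i) := by
            rw [← Int.self_sub_floor]; simp only [PiLp.sub_apply, hw']; ring
          rw [e, Real.norm_of_nonneg (Int.fract_nonneg _)]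
          have := Int.fract_nonneg (w i - w₀ i)
          have := Int.fract_lt_one (w i - w₀ i)
          nlinarith
      _ = N := by simp
  have hmv := convex_univ.norm_image_sub_le_of_norm_fderiv_le (𝕜 := ℝ) (f := f) (C := K)
    (fun v _ => hfd v) (fun v _ => hfK v) (Set.mem_univ (WithLp.toLp 2 w₀))
    (Set.mem_univ (WithLp.toLp 2 w'))
  have e1 : f (WithLp.toLp 2 w') = m₀ (tproj w) := by rw [hww]; rfl
  have e2 : f (WithLp.toLp 2 w₀) = m₀ (tproj w₀) := rfl
  rw [e1, e2] at hmv
  have := (le_abs_self _).trans (hmv.trans (mul_le_mul_of_nonneg_left hdist hK0))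
  linarith

/-- The functions `a(t) cos (2πk · x + θ)` with smooth `a`. -/
def modeSet (N : ℕ) : Set C(Torus N × ℝ, ℝ) :=
  {f | ∃ (a : ℝ → ℝ) (k : Fin N → ℤ) (θ : ℝ), ContDiff ℝ ∞ a ∧ ∀ p, f p = a p.2 * tmode k θ p.1}

/-- The subalgebra of trigonometric polynomials in space with smooth coefficients in time. -/
def trigAlgebra (N : ℕ) : Subalgebra ℝ C(Torus N × ℝ, ℝ) :=
  (Submodule.span ℝ (modeSet N)).toSubalgebra
    (Submodule.subset_span ⟨fun _ => 1, 0, 0, contDiff_const, fun p => by simp [tmode_zero]⟩)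
    (by
      intro f g hf hg
      induction hf, hg using Submodule.span_induction₂ with
      | mem_mem f g hf hg =>
        obtain ⟨a, k, θ, ha, hf⟩ := hf
        obtain ⟨b, l, η, hb, hg⟩ := hg
        have hmode : ∀ (k : Fin N → ℤ) (θ : ℝ),
            Continuous fun p : Torus N × ℝ => 1 / 2 * (a p.2 * b p.2) * tmode k θ p.1 :=
          fun k θ => (continuous_const.mul ((ha.continuous.comp continuous_snd).mul
            (hb.continuous.comp continuous_snd))).mul ((continuous_tmode k θ).comp continuous_fst)
        have e : f * g = (⟨_, hmode (k + l) (θ + η)⟩ : C(Torus N × ℝ, ℝ))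
            + ⟨_, hmode (k - l) (θ - η)⟩ := by
          ext p
          simp only [ContinuousMap.mul_apply, ContinuousMap.add_apply, ContinuousMap.coe_mk, hf, hg]
          linear_combination a p.2 * b p.2 * tmode_mul k l θ η p.1
        rw [e]
        have hab : ContDiff ℝ ∞ fun t => 1 / 2 * (a t * b t) := contDiff_const.mul (ha.mul hb)
        exact add_mem (Submodule.subset_span ⟨_, _, _, hab, fun _ => rfl⟩)
          (Submodule.subset_span ⟨_, _, _, hab, fun _ => rfl⟩)
      | zero_left => simp
      | zero_right => simp
      | add_left _ _ _ _ _ _ h1 h2 => rw [add_mul]; exact add_mem h1 h2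
      | add_right _ _ _ _ _ _ h1 h2 => rw [mul_add]; exact add_mem h1 h2
      | smul_left r _ _ _ _ h => rw [smul_mul_assoc]; exact Submodule.smul_mem _ _ h
      | smul_right r _ _ _ _ h => rw [mul_smul_comm]; exact Submodule.smul_mem _ _ h)

theorem trigAlgebra_separatesPoints (N : ℕ) : (trigAlgebra N).SeparatesPoints := by
  intro p q hpq
  by_cases h : p.1 = q.1
  · have h2 : p.2 ≠ q.2 := fun h2 => hpq (Prod.ext h h2)
    refine ⟨_, ⟨(⟨Prod.snd, continuous_snd⟩ : C(Torus N × ℝ, ℝ)), ?_, rfl⟩, h2⟩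
    exact Submodule.subset_span ⟨id, 0, 0, contDiff_id, fun p => by simp [tmode_zero]⟩
  · obtain ⟨k, θ, hk⟩ := exists_tmode_ne h
    refine ⟨_, ⟨(⟨fun p => tmode k θ p.1, (continuous_tmode k θ).comp continuous_fst⟩ :
      C(Torus N × ℝ, ℝ)), ?_, rfl⟩, hk⟩
    exact Submodule.subset_span ⟨fun _ => 1, k, θ, contDiff_const, fun p => by simp⟩

theorem exists_eq_trigSum {f : C(Torus N × ℝ, ℝ)} (hf : f ∈ trigAlgebra N) :
    ∃ (n : ℕ) (a : Fin n → ℝ → ℝ) (k : Fin n → Fin N → ℤ) (θ : Fin n → ℝ),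
      (∀ j, ContDiff ℝ ∞ (a j)) ∧ ∀ p, f p = trigSum a k θ p := by
  obtain ⟨n, c, g, hg⟩ := Submodule.mem_span_set'.1 (show f ∈ Submodule.span ℝ (modeSet N) from hf)
  choose a k θ ha hgp using fun j => (g j).2
  refine ⟨n, fun j t => c j * a j t, k, θ, fun j => contDiff_const.mul (ha j), fun p => ?_⟩
  rw [← hg]
  simp [trigSum, hgp, mul_assoc]

/-- Trigonometric sums vanishing near the final time are dense in `L^q(Q)`. -/
theorem exists_trigSum_eLpNorm_sub_le {T : ℝ} {q : ℝ≥0∞} (hq1 : 1 ≤ q) (hq : q ≠ ⊤)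
    {f : Torus N × ℝ → ℝ} (hf : MemLp f q (volQ N T)) {ε : ℝ} (hε : 0 < ε) :
    ∃ (n : ℕ) (a : Fin n → ℝ → ℝ) (k : Fin n → Fin N → ℤ) (θ : Fin n → ℝ) (τ : ℝ), τ < T ∧
      (∀ j, ContDiff ℝ ∞ (a j)) ∧ (∀ j t, τ ≤ t → a j t = 0) ∧
      eLpNorm (fun p => trigSum a k θ p - f p) q (volQ N T) ≤ ENNReal.ofReal ε := by
  have hε3 : 0 < ε / 3 := by positivity
  obtain ⟨u, hu, humem⟩ := hf.exists_boundedContinuous_eLpNorm_sub_le hq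
    (ENNReal.ofReal_pos.2 hε3).ne'
  obtain ⟨δ, hδ, hδu⟩ := humem.eLpNorm_indicator_le hq1 hq hε3
  set d := δ / 2 with hd
  have hd0 : 0 < d := by positivity
  set χ : ℝ → ℝ := fun t => Real.smoothTransition ((T - d - t) / d) with hχ
  have hχs : ContDiff ℝ ∞ χ := by
    refine Real.smoothTransition.contDiff.comp ?_
    fun_prop
  have hχ0 : ∀ t, T - d ≤ t → χ t = 0 := fun t ht =>
    Real.smoothTransition.zero_of_nonpos (div_nonpos_of_nonpos_of_nonneg (by linarith) hd0.le)
  have hχ1 : ∀ t, t ≤ T - δ → χ t = 1 := fun t ht =>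
    Real.smoothTransition.one_of_one_le (by rw [one_le_div hd0]; linarith)
  have hχn : ∀ t, 0 ≤ χ t := fun t => Real.smoothTransition.nonneg _
  have hχl : ∀ t, χ t ≤ 1 := fun t => Real.smoothTransition.le_one _
  -- The cut-off `χ` changes `u` only on `(T - δ, T)`, a set of measure at most `δ`.
  set s : Set (Torus N × ℝ) := Set.univ ×ˢ Set.Ioi (T - δ) with hs
  have hsm : MeasurableSet s := MeasurableSet.univ.prod measurableSet_Ioi
  have hsμ : volQ N T s ≤ ENNReal.ofReal δ := by
    rw [hs, volQ, Measure.prod_prod, measure_univ, one_mul, Measure.restrict_apply measurableSet_Ioi]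
    refine (measure_mono (t := Set.Ioo (T - δ) T) fun t ht => ⟨ht.1, ht.2.2⟩).trans_eq ?_
    rw [Real.volume_Ioo]; congr 1; ring
  have hcut : eLpNorm (fun p => χ p.2 * u p - u p) q (volQ N T) ≤ ENNReal.ofReal (ε / 3) := by
    refine (eLpNorm_mono fun p => ?_).trans (hδu s hsm hsμ)
    by_cases hp : p ∈ s
    · rw [Set.indicator_of_mem hp, show χ p.2 * u p - u p = (χ p.2 - 1) * u p by ring, norm_mul]
      refine mul_le_of_le_one_left (norm_nonneg _) ?_
      rw [Real.norm_eq_abs, abs_le]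
      constructor <;> linarith [hχn p.2, hχl p.2]
    · have : p.2 ≤ T - δ := by
        by_contra h; exact hp ⟨trivial, not_le.1 h⟩
      simp [Set.indicator_of_notMem hp, hχ1 _ this]
  set V := (volQ N T Set.univ ^ (q.toReal⁻¹)).toReal with hV
  have hVtop : volQ N T Set.univ ^ (q.toReal⁻¹) ≠ ⊤ :=
    ENNReal.rpow_ne_top_of_nonneg (by positivity) (measure_ne_top _ _)
  set η := ε / 3 / (V + 1) with hη
  have hη0 : 0 < η := by positivity
  obtain ⟨v, hv, hvu⟩ :=
    ContinuousMap.exists_mem_subalgebra_near_continuous_of_isCompact_of_separatesPoints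
      (trigAlgebra_separatesPoints N) u.toContinuousMap
      (isCompact_univ.prod (isCompact_Icc (a := 0) (b := T))) hη0
  obtain ⟨n, a, k, θ, ha, hva⟩ := exists_eq_trigSum hv
  refine ⟨n, fun j t => χ t * a j t, k, θ, T - d, by linarith, fun j => hχs.mul (ha j),
    fun j t ht => by simp [hχ0 t ht], ?_⟩
  have hsum : ∀ p, trigSum (fun j t => χ t * a j t) k θ p = χ p.2 * v p := fun p => by
    rw [hva, trigSum, trigSum, Finset.mul_sum]
    exact Finset.sum_congr rfl fun j _ => by ring
  have hclose : eLpNorm (fun p => χ p.2 * v p - χ p.2 * u p) q (volQ N T)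
      ≤ ENNReal.ofReal (ε / 3) := by
    refine (eLpNorm_le_of_ae_bound (C := η) ?_).trans ?_
    · filter_upwards [ae_mem_volQ N T] with p hp
      rw [← mul_sub, norm_mul, Real.norm_of_nonneg (hχn _)]
      refine (mul_le_of_le_one_left (norm_nonneg _) (hχl _)).trans ?_
      exact (hvu p ⟨trivial, hp.1.le, hp.2.le⟩).le
    · rw [← ENNReal.ofReal_toReal hVtop, ← ENNReal.ofReal_mul ENNReal.toReal_nonneg]
      refine ENNReal.ofReal_le_ofReal ?_
      rw [← hV, hη, mul_div_assoc', div_le_iff₀ (by positivity)]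
      nlinarith
  have hvc : AEStronglyMeasurable (fun p : Torus N × ℝ => χ p.2 * v p) (volQ N T) :=
    ((hχs.continuous.comp continuous_snd).mul v.continuous).aestronglyMeasurable
  have huc : AEStronglyMeasurable (fun p : Torus N × ℝ => χ p.2 * u p) (volQ N T) :=
    ((hχs.continuous.comp continuous_snd).mul u.continuous).aestronglyMeasurable
  have hu1 : AEStronglyMeasurable u (volQ N T) := u.continuous.aestronglyMeasurable
  have e : (fun p => trigSum (fun j t => χ t * a j t) k θ p - f p)
      = (fun p => χ p.2 * v p - χ p.2 * u p) + ((fun p => χ p.2 * u p - u p) + (⇑u - f)) := by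
    ext p; simp only [hsum, Pi.add_apply, Pi.sub_apply]; ring
  rw [e]
  refine (eLpNorm_add_le (hvc.sub huc) ((huc.sub hu1).add (hu1.sub hf.1)) hq1).trans ?_
  have h3 : ENNReal.ofReal ε = ENNReal.ofReal (ε / 3)
      + (ENNReal.ofReal (ε / 3) + ENNReal.ofReal (ε / 3)) := by
    rw [← ENNReal.ofReal_add hε3.le hε3.le, ← ENNReal.ofReal_add hε3.le (by positivity)]
    congr 1; ring
  rw [h3]
  refine add_le_add hclose ((eLpNorm_add_le (huc.sub hu1) (hu1.sub hf.1) hq1).trans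
    (add_le_add hcut ?_))
  rwa [eLpNorm_sub_comm]

/-! ### The duality estimate for measurable sets -/

/-- Duality estimate against smooth functions: the heat flow over the time step `h` splits `m` into
a part bounded by the heat kernel and a part of size `√h` controlled by the flux. -/
theorem enorm_integral_mul_trigSum_le {T : ℝ} {m₀ : Torus N → ℝ} (h₀ : ∫ x, m₀ x = 1)
    (hm₀ : ∀ x, 0 ≤ m₀ x) {B : ℝ} (hB : ∀ x, m₀ x ≤ B)
    {A : Torus N × ℝ → EuclideanSpace ℝ (Fin N)} (hA : AEStronglyMeasurable A (volQ N T))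
    {m : Torus N × ℝ → ℝ} (hm : ∀ᵐ p ∂volQ N T, 0 ≤ m p) (hw : IsWeakSolution T m₀ A m)
    {γ' γ p p' : ℝ} (hγ : γ'.HolderConjugate γ) (hp : p.HolderConjugate p')
    {h : ℝ} (hh : 0 ≤ h) {c : ℝ≥0∞}
    (hc : (gauss N).map (heatShift h) ≤ c • (volume : Measure (Torus N)))
    {τ : ℝ} (hτ : τ < T) {a : Fin n → ℝ → ℝ} (ha : ∀ j, ContDiff ℝ ∞ (a j))
    (ha0 : ∀ j t, τ ≤ t → a j t = 0) (k : Fin n → Fin N → ℤ) (θ : Fin n → ℝ) :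
    ‖∫ p, m p * trigSum a k θ p ∂volQ N T‖ₑ
      ≤ (c + ENNReal.ofReal B) * ∫⁻ p, ‖trigSum a k θ p‖ₑ ∂volQ N T
        + N * (ENNReal.ofReal (√2 * √h) * gaussMoment
          * ((∫⁻ p, ‖A p‖ₑ ^ γ' * ENNReal.ofReal (m p) ∂volQ N T) ^ (1 / γ')
            * (∫⁻ x, ENNReal.ofReal (m x) ^ p ∂volQ N T) ^ (1 / (p * γ))))
          * (∫⁻ p, ‖trigSum a k θ p‖ₑ ^ (γ * p') ∂volQ N T) ^ (1 / (γ * p')) := by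
  -- A non-integrable density would have integral zero.
  have hint : Integrable m₀ := by
    by_contra h
    rw [integral_undef h] at h₀
    exact zero_ne_one h₀
  have hmm : AEMeasurable (fun p => ENNReal.ofReal (m p)) (volQ N T) :=
    hw.integrable.aemeasurable.ennreal_ofReal
  have hme : ∀ᵐ p ∂volQ N T, ‖m p‖ₑ = ENNReal.ofReal (m p) :=
    hm.mono fun p hp => Real.enorm_of_nonneg hp
  have hγp : 1 < γ * p' := by nlinarith [hγ.symm.lt, hp.symm.lt]
  rw [integral_mul_trigSum hint hw hτ hh ha ha0 k θ]
  have t1 : ‖∫ p, m p * trigHeat h a k θ p ∂volQ N T‖ₑ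
      ≤ c * ∫⁻ p, ‖trigSum a k θ p‖ₑ ∂volQ N T := by
    refine (enorm_integral_le_lintegral_enorm _).trans (le_trans (le_of_eq ?_)
      (lintegral_mul_trigHeat_le hτ ha ha0 hh hc hmm (ae_lintegral_eq_one h₀ hw hm)))
    refine lintegral_congr_ae (hme.mono fun p hp => ?_)
    simp only [enorm_mul, hp]
  have t3 : ‖∫ x, m₀ x * trigInit h a k θ x‖ₑ
      ≤ ENNReal.ofReal B * ∫⁻ p, ‖trigSum a k θ p‖ₑ ∂volQ N T := by
    refine (enorm_integral_le_lintegral_enorm _).trans (le_trans ?_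
      (mul_le_mul_right (lintegral_trigInit_le hτ ha ha0 hh) _))
    rw [← lintegral_const_mul' _ _ ENNReal.ofReal_ne_top]
    refine lintegral_mono fun x => ?_
    rw [enorm_mul, Real.enorm_of_nonneg (hm₀ x)]
    gcongr
    exact hB x
  have t2 : ∀ i : Fin N, ‖∫ p, (m p * A p i) * trigGrad h a k θ i p ∂volQ N T‖ₑ
      ≤ (ENNReal.ofReal (√2 * √h) * gaussMoment
          * ((∫⁻ p, ‖A p‖ₑ ^ γ' * ENNReal.ofReal (m p) ∂volQ N T) ^ (1 / γ')
            * (∫⁻ x, ENNReal.ofReal (m x) ^ p ∂volQ N T) ^ (1 / (p * γ))))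
          * (∫⁻ p, ‖trigSum a k θ p‖ₑ ^ (γ * p') ∂volQ N T) ^ (1 / (γ * p')) := by
    intro i
    have hψ : Measurable fun p => ‖trigGrad h a k θ i p‖ₑ :=
      (continuous_trigGrad h ha k θ i).measurable.enorm
    refine (enorm_integral_le_lintegral_enorm _).trans ?_
    calc ∫⁻ p, ‖(m p * A p i) * trigGrad h a k θ i p‖ₑ ∂volQ N T
        ≤ ∫⁻ p, ENNReal.ofReal (m p) * ‖A p‖ₑ * ‖trigGrad h a k θ i p‖ₑ ∂volQ N T := by
          refine lintegral_mono_ae (hme.mono fun p hp => ?_)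
          simp only [enorm_mul, hp]
          gcongr
          rw [← ofReal_norm, ← ofReal_norm]
          exact ENNReal.ofReal_le_ofReal (PiLp.norm_apply_le (A p) i)
      _ ≤ _ := lintegral_flux_le hγ hp hmm hA.enorm hψ.aemeasurable
      _ ≤ _ := by
          have hX := ENNReal.rpow_le_rpow (lintegral_trigGrad_rpow_le (k := k) (θ := θ) hτ ha ha0 hh
            hγp i) (by positivity : 0 ≤ 1 / (γ * p'))
          rw [ENNReal.mul_rpow_of_nonneg _ _ (by positivity), ← ENNReal.rpow_mul,
            mul_one_div_cancel (by positivity), ENNReal.rpow_one] at hX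
          refine (mul_le_mul_right hX _).trans_eq ?_
          ring
  refine (enorm_add_le _ _).trans ((add_le_add (enorm_add_le _ _) t3).trans ?_)
  refine (add_le_add (add_le_add t1 ((enorm_sum_le _ _).trans
    (Finset.sum_le_sum fun i _ => t2 i))) le_rfl).trans_eq ?_
  rw [Finset.sum_const, Finset.card_univ, Fintype.card_fin, nsmul_eq_mul]
  ring

/-- A duality estimate known for trigonometric sums extends by density to indicators of measurable
sets. Since `m ∈ L^p` and `q` is at least the conjugate exponent of `p`, every term is continuous for
the `L^q` norm of the test function. -/
theorem setLIntegral_le_of_approx {T : ℝ} {m : Torus N × ℝ → ℝ} (hmi : Integrable m (volQ N T))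
    (hm : ∀ᵐ p ∂volQ N T, 0 ≤ m p) {p p' q : ℝ} (hp : p.HolderConjugate p') (hq : p' ≤ q)
    (hM : ∫⁻ x, ENNReal.ofReal (m x) ^ p ∂volQ N T ≠ ⊤) {C₁ C₂ : ℝ≥0∞} (hC₁ : C₁ ≠ ⊤) (hC₂ : C₂ ≠ ⊤)
    (H : ∀ (n : ℕ) (a : Fin n → ℝ → ℝ) (k : Fin n → Fin N → ℤ) (θ : Fin n → ℝ) (τ : ℝ), τ < T →
      (∀ j, ContDiff ℝ ∞ (a j)) → (∀ j t, τ ≤ t → a j t = 0) →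
      ‖∫ p, m p * trigSum a k θ p ∂volQ N T‖ₑ ≤ C₁ * ∫⁻ p, ‖trigSum a k θ p‖ₑ ∂volQ N T
        + C₂ * (∫⁻ p, ‖trigSum a k θ p‖ₑ ^ q ∂volQ N T) ^ (1 / q))
    {S : Set (Torus N × ℝ)} (hS : MeasurableSet S) :
    ∫⁻ p in S, ENNReal.ofReal (m p) ∂volQ N T
      ≤ C₁ * volQ N T S + C₂ * volQ N T S ^ (1 / q) := by
  have hq1 : 1 < q := hp.symm.lt.trans_le hq
  have hq0 : 0 < q := by linarith
  have hqq : (1 : ℝ≥0∞) ≤ ENNReal.ofReal q := by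
    rw [← ENNReal.ofReal_one]; exact ENNReal.ofReal_le_ofReal hq1.le
  set f : Torus N × ℝ → ℝ := S.indicator fun _ => 1 with hf
  have hfm : MemLp f (ENNReal.ofReal q) (volQ N T) := (memLp_const (1 : ℝ)).indicator hS
  have hq' : (ENNReal.ofReal q).toReal = q := ENNReal.toReal_ofReal hq0.le
  have hLq : ∀ g : Torus N × ℝ → ℝ, eLpNorm g (ENNReal.ofReal q) (volQ N T)
      = (∫⁻ p, ‖g p‖ₑ ^ q ∂volQ N T) ^ (1 / q) := fun g => by
    rw [eLpNorm_eq_lintegral_rpow_enorm_toReal (by simpa using hq0) ENNReal.ofReal_ne_top, hq']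
  have hfq : eLpNorm f (ENNReal.ofReal q) (volQ N T) = volQ N T S ^ (1 / q) := by
    rw [hf, eLpNorm_indicator_const hS (by simpa using hq0) ENNReal.ofReal_ne_top, hq']
    simp
  have hf1 : eLpNorm f 1 (volQ N T) = volQ N T S := by
    rw [hf, eLpNorm_indicator_const hS one_ne_zero ENNReal.one_ne_top]
    simp
  have hme : ∀ᵐ p ∂volQ N T, ‖m p‖ₑ = ENNReal.ofReal (m p) :=
    hm.mono fun p hp => Real.enorm_of_nonneg hp
  have hmf : Integrable (fun p => m p * f p) (volQ N T) :=
    hmi.mul_bdd (c := 1) hfm.1 (ae_of_all _ fun p => by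
      by_cases hp : p ∈ S <;> simp [hf, hp])
  have hleft : ∫⁻ p in S, ENNReal.ofReal (m p) ∂volQ N T = ‖∫ p, m p * f p ∂volQ N T‖ₑ := by
    have h0 : ∀ᵐ p ∂volQ N T, 0 ≤ m p * f p := hm.mono fun p hp =>
      mul_nonneg hp (Set.indicator_nonneg (fun _ _ => zero_le_one) _)
    rw [Real.enorm_of_nonneg (integral_nonneg_of_ae h0),
      ofReal_integral_eq_lintegral_ofReal hmf h0, ← lintegral_indicator hS]
    refine lintegral_congr fun p => ?_
    by_cases hp : p ∈ S <;> simp [hf, hp]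
  set L : ℝ≥0∞ := C₁ * volQ N T Set.univ ^ (1 / (1 : ℝ≥0∞).toReal - 1 / q) + C₂
    + (∫⁻ x, ENNReal.ofReal (m x) ^ p ∂volQ N T) ^ (1 / p)
      * volQ N T Set.univ ^ (1 / p' - 1 / q) with hL
  have hLtop : L ≠ ⊤ := by
    have e1 : 0 ≤ 1 / (1 : ℝ≥0∞).toReal - 1 / q := by
      rw [ENNReal.toReal_one, div_one, sub_nonneg, div_le_one hq0]; exact hq1.le
    have e2 : 0 ≤ 1 / p' - 1 / q := sub_nonneg.2 (one_div_le_one_div_of_le hp.symm.pos hq)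
    refine ENNReal.add_ne_top.2 ⟨ENNReal.add_ne_top.2 ⟨ENNReal.mul_ne_top hC₁ ?_, hC₂⟩,
      ENNReal.mul_ne_top ?_ ?_⟩
    · exact ENNReal.rpow_ne_top_of_nonneg e1 (measure_ne_top _ _)
    · exact ENNReal.rpow_ne_top_of_nonneg hp.one_div_nonneg hM
    · exact ENNReal.rpow_ne_top_of_nonneg e2 (measure_ne_top _ _)
  have key : ∀ ε : ℝ, 0 < ε → ∫⁻ p in S, ENNReal.ofReal (m p) ∂volQ N T
      ≤ C₁ * volQ N T S + C₂ * volQ N T S ^ (1 / q) + L * ENNReal.ofReal ε := by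
    intro ε hε
    obtain ⟨n, a, k, θ, τ, hτ, ha, ha0, happ⟩ :=
      exists_trigSum_eLpNorm_sub_le hqq ENNReal.ofReal_ne_top hfm hε
    set g := trigSum a k θ with hg
    have hgc : Continuous g := continuous_trigSum ha k θ
    have hgm : AEStronglyMeasurable g (volQ N T) := hgc.aestronglyMeasurable
    have hdm : AEStronglyMeasurable (fun p => g p - f p) (volQ N T) := hgm.sub hfm.1
    have hg_eq : g = f + fun p => g p - f p := by ext p; simp
    have n1 : (∫⁻ p, ‖g p‖ₑ ^ q ∂volQ N T) ^ (1 / q)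
        ≤ volQ N T S ^ (1 / q) + ENNReal.ofReal ε := by
      rw [← hLq, ← hfq]
      nth_rewrite 1 [hg_eq]
      exact (eLpNorm_add_le hfm.1 hdm hqq).trans (add_le_add le_rfl happ)
    have n2 : ∫⁻ p, ‖g p‖ₑ ∂volQ N T ≤ volQ N T S
        + volQ N T Set.univ ^ (1 / (1 : ℝ≥0∞).toReal - 1 / q) * ENNReal.ofReal ε := by
      rw [← eLpNorm_one_eq_lintegral_enorm, ← hf1]
      nth_rewrite 1 [hg_eq]
      refine (eLpNorm_add_le hfm.1 hdm le_rfl).trans (add_le_add le_rfl ?_)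
      refine (eLpNorm_le_eLpNorm_mul_rpow_measure_univ hqq hdm).trans ?_
      rw [hq', mul_comm]
      exact mul_le_mul_right happ _
    have n3 : ∫⁻ p, ENNReal.ofReal (m p) * ‖g p - f p‖ₑ ∂volQ N T
        ≤ (∫⁻ x, ENNReal.ofReal (m x) ^ p ∂volQ N T) ^ (1 / p)
          * volQ N T Set.univ ^ (1 / p' - 1 / q) * ENNReal.ofReal ε := by
      refine (ENNReal.lintegral_mul_le_Lp_mul_Lq _ hp hmi.aemeasurable.ennreal_ofReal
        hdm.enorm).trans ?_
      rw [mul_assoc]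
      refine mul_le_mul_right ?_ _
      have hp0 := hp.symm.pos
      have := eLpNorm_le_eLpNorm_mul_rpow_measure_univ (ENNReal.ofReal_le_ofReal hq) hdm
      rw [hq', ENNReal.toReal_ofReal hp0.le, eLpNorm_eq_lintegral_rpow_enorm_toReal
        (by simpa using hp0) ENNReal.ofReal_ne_top, ENNReal.toReal_ofReal hp0.le] at this
      refine this.trans ?_
      rw [mul_comm]
      exact mul_le_mul_right happ _
    have hmg : Integrable (fun p => m p * g p) (volQ N T) := integrable_mul_of_continuous hmi hgc
    have hsplit : ∫ p, m p * f p ∂volQ N T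
        = ∫ p, m p * g p ∂volQ N T - ∫ p, m p * (g p - f p) ∂volQ N T := by
      have := integral_sub hmg hmf
      simp only [mul_sub]
      rw [this]; ring
    have n4 : ‖∫ p, m p * (g p - f p) ∂volQ N T‖ₑ
        ≤ ∫⁻ p, ENNReal.ofReal (m p) * ‖g p - f p‖ₑ ∂volQ N T := by
      refine (enorm_integral_le_lintegral_enorm _).trans_eq ?_
      exact lintegral_congr_ae (hme.mono fun p hp => by simp only [enorm_mul, hp])
    rw [hleft, hsplit]
    refine enorm_sub_le.trans ((add_le_add (H n a k θ τ hτ ha ha0) (n4.trans n3)).trans ?_)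
    refine (add_le_add (add_le_add (mul_le_mul_right n2 C₁) (mul_le_mul_right n1 C₂))
      le_rfl).trans_eq ?_
    rw [hL]; ring
  refine ENNReal.le_of_forall_pos_le_add fun ε hε _ => ?_
  have hη : 0 < (ε : ℝ) / (L.toReal + 1) := by positivity
  refine (key _ hη).trans (add_le_add le_rfl ?_)
  have h0 : L * ENNReal.ofReal (ε / (L.toReal + 1))
      = ENNReal.ofReal (L.toReal * (ε / (L.toReal + 1))) := by
    rw [ENNReal.ofReal_mul ENNReal.toReal_nonneg, ENNReal.ofReal_toReal hLtop]
  rw [h0, ← ENNReal.ofReal_coe_nnreal]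
  refine ENNReal.ofReal_le_ofReal ?_
  rw [mul_div_assoc', div_le_iff₀ (by positivity)]
  nlinarith [NNReal.coe_pos.2 hε]

/-! ### From the duality estimate to the power bound -/

/-- Optimising the splitting parameter `η = √h` in the duality estimate for a level set: the choice
`η = (2G/λ)^{1/N}` absorbs the first term and yields a weak-type bound. -/
theorem weak_type_of_duality (hN : 1 ≤ N) {G D Φ V l q q' : ℝ} (hG : 0 < G) (hD : 0 ≤ D)
    (hΦ : 0 ≤ Φ) (hV : 0 ≤ V) (hl : 2 * G ≤ l) (hq : q.HolderConjugate q')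
    (H : ∀ η : ℝ, 0 < η → η ≤ 1 → l * V ≤ G * (1 / η) ^ N * V + D * η * Φ * V ^ (1 / q')) :
    V ≤ (2 * D * (2 * G) ^ (1 / (N : ℝ)) * Φ) ^ q * l ^ (-(q * (1 + 1 / N))) := by
  have hl0 : 0 < l := by linarith
  have hN0 : (N : ℝ) ≠ 0 := by positivity
  rcases hV.eq_or_lt with rfl | hV0
  · positivity
  set η : ℝ := (2 * G / l) ^ (1 / (N : ℝ)) with hη
  have hη0 : 0 < η := by positivity
  have hη1 : η ≤ 1 := Real.rpow_le_one (by positivity) ((div_le_one hl0).2 hl) (by positivity)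
  have hηN : η ^ N = 2 * G / l := by
    rw [hη, ← Real.rpow_natCast, ← Real.rpow_mul (by positivity), one_div_mul_cancel hN0,
      Real.rpow_one]
  have h1 := H η hη0 hη1
  have h2 : G * (1 / η) ^ N = l / 2 := by
    rw [one_div, inv_pow, hηN]; field_simp
  rw [h2] at h1
  have h3 : V ^ (1 / q') * V ^ (1 / q) = V := by
    rw [← Real.rpow_add hV0, one_div, one_div, add_comm, hq.inv_add_inv_eq_one, Real.rpow_one]
  have h4 : V ^ (1 / q) ≤ 2 * D * (2 * G) ^ (1 / (N : ℝ)) * Φ * l ^ (-(1 + 1 / (N : ℝ))) := by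
    have h5 : V ^ (1 / q') * (l * V ^ (1 / q)) ≤ V ^ (1 / q') * (2 * D * η * Φ) := by
      rw [mul_left_comm, h3]; linarith
    have h6 := le_of_mul_le_mul_left h5 (by positivity)
    have h7 : η = (2 * G) ^ (1 / (N : ℝ)) * l ^ (-(1 / (N : ℝ))) := by
      rw [hη, Real.div_rpow (by positivity) hl0.le, Real.rpow_neg hl0.le, div_eq_mul_inv]
    have h8 : l ^ (-(1 + 1 / (N : ℝ))) = l⁻¹ * l ^ (-(1 / (N : ℝ))) := by
      rw [neg_add, Real.rpow_add hl0, Real.rpow_neg_one]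
    rw [h8]
    rw [h7] at h6
    calc V ^ (1 / q) = l⁻¹ * (l * V ^ (1 / q)) := by field_simp
      _ ≤ l⁻¹ * (2 * D * ((2 * G) ^ (1 / (N : ℝ)) * l ^ (-(1 / (N : ℝ)))) * Φ) := by gcongr
      _ = _ := by ring
  calc V = (V ^ (1 / q)) ^ q := by
        rw [← Real.rpow_mul hV, one_div_mul_cancel hq.ne_zero, Real.rpow_one]
    _ ≤ (2 * D * (2 * G) ^ (1 / (N : ℝ)) * Φ * l ^ (-(1 + 1 / (N : ℝ)))) ^ q :=
        Real.rpow_le_rpow (by positivity) h4 hq.nonneg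
    _ = _ := by
        rw [Real.mul_rpow (by positivity) (by positivity), ← Real.rpow_mul hl0.le]
        congr 2; ring

/-- Layer-cake interpolation between a weak `L^1` bound (used below the height `Λ`) and a weak `L^r`
bound, `r > p` (used above it). -/
theorem lintegral_rpow_le_of_weak_type {X : Type*} [MeasurableSpace X] {μ : Measure X} {f : X → ℝ}
    (hf : AEMeasurable f μ) (hf0 : 0 ≤ᵐ[μ] f) {p r T W Λ : ℝ} (hp : 1 < p) (hr : p < r) (hT : 0 ≤ T)
    (hW : 0 ≤ W) (hΛ : 0 < Λ) (h1 : ∀ t, 0 < t → μ {x | t < f x} ≤ ENNReal.ofReal (T / t))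
    (h2 : ∀ t, Λ ≤ t → μ {x | t < f x} ≤ ENNReal.ofReal (W * t ^ (-r))) :
    ∫⁻ x, ENNReal.ofReal (f x ^ p) ∂μ
      ≤ ENNReal.ofReal (p * (T * Λ ^ (p - 1) / (p - 1) + W * Λ ^ (p - r) / (r - p))) := by
  rw [lintegral_rpow_eq_lintegral_meas_lt_mul μ hf0 hf (by linarith),
    ENNReal.ofReal_mul (by linarith)]
  refine mul_le_mul_right ?_ _
  have hp1 : 0 < p - 1 := by linarith
  have hrp : 0 < r - p := by linarith
  rw [← Set.Ioc_union_Ioi_eq_Ioi hΛ.le, lintegral_union measurableSet_Ioi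
    (Set.Ioc_disjoint_Ioi le_rfl), ENNReal.ofReal_add (by positivity) (by positivity)]
  refine add_le_add ?_ ?_
  · have hint : IntegrableOn (fun t : ℝ => T * t ^ (p - 2)) (Set.Ioc 0 Λ) := by
      rw [← intervalIntegrable_iff_integrableOn_Ioc_of_le hΛ.le]
      exact (intervalIntegral.intervalIntegrable_rpow' (by linarith)).const_mul _
    calc ∫⁻ t in Set.Ioc 0 Λ, μ {x | t < f x} * ENNReal.ofReal (t ^ (p - 1))
        ≤ ∫⁻ t in Set.Ioc 0 Λ, ENNReal.ofReal (T * t ^ (p - 2)) := by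
          refine setLIntegral_mono' measurableSet_Ioc fun t ht => ?_
          refine (mul_le_mul_left (h1 t ht.1) _).trans_eq ?_
          rw [← ENNReal.ofReal_mul (div_nonneg hT ht.1.le)]
          congr 1
          rw [show p - 1 = (p - 2) + 1 by ring, Real.rpow_add ht.1, Real.rpow_one]
          have := ht.1.ne'
          field_simp
      _ = ENNReal.ofReal (T * Λ ^ (p - 1) / (p - 1)) := by
          rw [← ofReal_integral_eq_lintegral_ofReal hint]
          · congr 1
            rw [← intervalIntegral.integral_of_le hΛ.le, intervalIntegral.integral_const_mul,
              integral_rpow (Or.inl (by linarith)), show p - 2 + 1 = p - 1 by ring,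
              Real.zero_rpow hp1.ne', sub_zero, mul_div_assoc]
          · filter_upwards [ae_restrict_mem measurableSet_Ioc] with t ht
            have := ht.1
            positivity
      _ ≤ _ := le_rfl
  · have hint : IntegrableOn (fun t : ℝ => W * t ^ (p - r - 1)) (Set.Ioi Λ) :=
      (integrableOn_Ioi_rpow_of_lt (by linarith) hΛ).const_mul _
    calc ∫⁻ t in Set.Ioi Λ, μ {x | t < f x} * ENNReal.ofReal (t ^ (p - 1))
        ≤ ∫⁻ t in Set.Ioi Λ, ENNReal.ofReal (W * t ^ (p - r - 1)) := by
          refine setLIntegral_mono' measurableSet_Ioi fun t ht => ?_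
          have ht0 : 0 < t := hΛ.trans ht
          refine (mul_le_mul_left (h2 t (le_of_lt ht)) _).trans_eq ?_
          rw [← ENNReal.ofReal_mul (by positivity), mul_assoc, ← Real.rpow_add ht0]
          congr 3; ring
      _ = ENNReal.ofReal (W * Λ ^ (p - r) / (r - p)) := by
          rw [← ofReal_integral_eq_lintegral_ofReal hint]
          · congr 1
            rw [integral_const_mul, integral_Ioi_rpow_of_lt (by linarith) hΛ,
              show p - r - 1 + 1 = -(r - p) by ring, show p - r = -(r - p) by ring]
            field_simp
          · filter_upwards [ae_restrict_mem measurableSet_Ioi] with t ht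
            have : 0 < t := hΛ.trans ht
            positivity
      _ ≤ _ := le_rfl

/-- Choosing the height `Λ` in the interpolation inequality. -/
theorem exists_le_rpow_of_interpolation {p r T W₀ Λ₀ : ℝ} (hp : 1 < p) (hr : p < r) (hT : 0 ≤ T)
    (hW₀ : 0 ≤ W₀) : ∃ C : ℝ, 0 < C ∧ ∀ M Y : ℝ, 0 ≤ Y →
      (∀ Λ, 0 < Λ → Λ₀ ≤ Λ →
        M ≤ p * (T * Λ ^ (p - 1) / (p - 1) + W₀ * Y * Λ ^ (p - r) / (r - p))) →
      M ≤ C * (1 + Y) ^ ((p - 1) / (r - 1)) := by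
  have hp1 : 0 < p - 1 := by linarith
  have hr1 : 0 < r - 1 := by linarith
  have hrp : 0 < r - p := by linarith
  set Λ₁ := max Λ₀ 1 with hΛ₁
  have h1 : 1 ≤ Λ₁ := le_max_right _ _
  refine ⟨p * (T * Λ₁ ^ (p - 1) / (p - 1) + W₀ / (r - p)) + 1, by positivity, fun M Y hY H => ?_⟩
  set X := 1 + Y with hX
  have hX1 : 1 ≤ X := by linarith
  have hX0 : 0 < X := by linarith
  have hs1 : 1 ≤ X ^ (1 / (r - 1)) := Real.one_le_rpow hX1 (by positivity)
  have hM := H (Λ₁ * X ^ (1 / (r - 1))) (by positivity)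
    ((le_max_left _ _).trans (le_mul_of_one_le_right (by linarith) hs1))
  set θ := (p - 1) / (r - 1) with hθ
  have e1 : (Λ₁ * X ^ (1 / (r - 1))) ^ (p - 1) = Λ₁ ^ (p - 1) * X ^ θ := by
    rw [Real.mul_rpow (by linarith) (by positivity), ← Real.rpow_mul hX0.le]
    congr 2; rw [hθ]; ring
  have e2 : Y * (Λ₁ * X ^ (1 / (r - 1))) ^ (p - r) ≤ X ^ θ := by
    rw [Real.mul_rpow (by linarith) (by positivity), ← Real.rpow_mul hX0.le]
    have h2 : Λ₁ ^ (p - r) ≤ 1 := Real.rpow_le_one_of_one_le_of_nonpos h1 (by linarith)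
    calc Y * (Λ₁ ^ (p - r) * X ^ (1 / (r - 1) * (p - r)))
        ≤ X * (1 * X ^ (1 / (r - 1) * (p - r))) := by gcongr; linarith
      _ = X ^ θ := by
          rw [one_mul]
          nth_rewrite 1 [← Real.rpow_one X]
          rw [← Real.rpow_add hX0]
          congr 1; rw [hθ]; field_simp; ring
  have hXθ : 0 ≤ X ^ θ := by positivity
  calc M ≤ p * (T * (Λ₁ ^ (p - 1) * X ^ θ) / (p - 1)
        + W₀ * (Y * (Λ₁ * X ^ (1 / (r - 1))) ^ (p - r)) / (r - p)) := by
        rw [← e1, ← mul_assoc W₀]; exact hM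
    _ ≤ p * (T * (Λ₁ ^ (p - 1) * X ^ θ) / (p - 1) + W₀ * X ^ θ / (r - p)) := by gcongr
    _ = p * (T * Λ₁ ^ (p - 1) / (p - 1) + W₀ / (r - p)) * X ^ θ := by ring
    _ ≤ _ := by gcongr; linarith

/-- Absorbing the power of `M` on the right-hand side. -/
theorem exists_rpow_le_of_absorption {C θ κ : ℝ} (hC : 0 < C) (hθ0 : 0 < θ) (hθ1 : θ < 1)
    (hκ0 : 0 < κ) (hκ1 : κ < 1) :
    ∃ C' : ℝ, 0 < C' ∧ ∃ δ : ℝ, 1 < δ ∧ ∀ M E : ℝ, 0 ≤ M → 0 ≤ E →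
      M ≤ C * (1 + E ^ κ * M ^ (1 - κ)) ^ θ → M ^ δ ≤ C' * (E + 1) := by
  have hθκ : 0 < θ * κ := by positivity
  have hden : 0 < 1 - θ * (1 - κ) := by nlinarith
  set δ := (1 - θ * (1 - κ)) / (θ * κ) with hδ
  have hδ1 : 1 < δ := by rw [hδ, one_lt_div hθκ]; nlinarith
  refine ⟨(C * 2 ^ θ) ^ (1 / (θ * κ)) + 1, by positivity, δ, hδ1, fun M E hM hE H => ?_⟩
  rcases le_or_gt M 1 with hM1 | hM1
  · have h1 : M ^ δ ≤ 1 := Real.rpow_le_one hM hM1 (by linarith)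
    have h2 : 0 ≤ (C * 2 ^ θ) ^ (1 / (θ * κ)) := by positivity
    nlinarith
  · have hM0 : 0 < M := by linarith
    have h1 : 1 + E ^ κ * M ^ (1 - κ) ≤ 2 * ((E + 1) ^ κ * M ^ (1 - κ)) := by
      have a1 : 1 ≤ (E + 1) ^ κ := Real.one_le_rpow (by linarith) hκ0.le
      have a2 : 1 ≤ M ^ (1 - κ) := Real.one_le_rpow hM1.le (by linarith)
      have a3 : E ^ κ ≤ (E + 1) ^ κ := Real.rpow_le_rpow hE (by linarith) hκ0.le
      have a4 : 1 ≤ (E + 1) ^ κ * M ^ (1 - κ) := one_le_mul_of_one_le_of_one_le a1 a2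
      have a5 : E ^ κ * M ^ (1 - κ) ≤ (E + 1) ^ κ * M ^ (1 - κ) := by gcongr
      linarith
    have h2 : M ≤ (C * 2 ^ θ) * (E + 1) ^ (θ * κ) * M ^ (θ * (1 - κ)) := by
      calc M ≤ C * (2 * ((E + 1) ^ κ * M ^ (1 - κ))) ^ θ := by
            refine H.trans ?_
            gcongr
        _ = _ := by
            rw [Real.mul_rpow zero_le_two (by positivity), Real.mul_rpow (by positivity)
              (by positivity), ← Real.rpow_mul (by linarith), ← Real.rpow_mul hM, mul_comm κ,
              mul_comm (1 - κ)]
            ring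
    have h3 : M ^ (1 - θ * (1 - κ)) ≤ (C * 2 ^ θ) * (E + 1) ^ (θ * κ) := by
      rw [Real.rpow_sub hM0, Real.rpow_one, div_le_iff₀ (by positivity)]
      exact h2
    have h4 := Real.rpow_le_rpow (by positivity) h3 (by positivity : 0 ≤ 1 / (θ * κ))
    rw [← Real.rpow_mul hM, Real.mul_rpow (by positivity) (by positivity),
      ← Real.rpow_mul (by linarith), mul_one_div_cancel hθκ.ne', Real.rpow_one,
      mul_one_div] at h4
    refine h4.trans ?_
    gcongr
    linarith

/-! ### The weak-type bound for solutions -/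

theorem lintegral_ofReal_eq {T : ℝ} {m₀ : Torus N → ℝ} (h₀ : ∫ x, m₀ x = 1)
    {A : Torus N × ℝ → EuclideanSpace ℝ (Fin N)}
    {m : Torus N × ℝ → ℝ} (hw : IsWeakSolution T m₀ A m) (hm : ∀ᵐ p ∂volQ N T, 0 ≤ m p) :
    ∫⁻ p, ENNReal.ofReal (m p) ∂volQ N T = ENNReal.ofReal T := by
  rw [lintegral_volQ hw.integrable.aemeasurable.ennreal_ofReal,
    lintegral_congr_ae (ae_lintegral_eq_one h₀ hw hm)]
  simp

theorem ofReal_mul_measure_le {X : Type*} [MeasurableSpace X] {μ : Measure X} {f : X → ℝ}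
    (hf : Measurable f) (t : ℝ) :
    ENNReal.ofReal t * μ {x | t < f x} ≤ ∫⁻ x in {x | t < f x}, ENNReal.ofReal (f x) ∂μ := by
  rw [← setLIntegral_const]
  exact setLIntegral_mono' (measurableSet_lt measurable_const hf)
    fun x hx => ENNReal.ofReal_le_ofReal (le_of_lt hx)

theorem ofReal_energy {T γ' : ℝ} (hγ' : 0 ≤ γ') {A : Torus N × ℝ → EuclideanSpace ℝ (Fin N)}
    {m : Torus N × ℝ → ℝ} (hm : ∀ᵐ p ∂volQ N T, 0 ≤ m p)
    (hE : Integrable (fun p => ‖A p‖ ^ γ' * m p) (volQ N T)) :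
    ∫⁻ p, ‖A p‖ₑ ^ γ' * ENNReal.ofReal (m p) ∂volQ N T = ENNReal.ofReal (energy T γ' A m) := by
  rw [energy, ofReal_integral_eq_lintegral_ofReal hE
    (hm.mono fun p hp => mul_nonneg (by positivity) hp)]
  refine lintegral_congr fun p => ?_
  rw [ENNReal.ofReal_mul (by positivity), ← ENNReal.ofReal_rpow_of_nonneg (norm_nonneg _) hγ',
    ofReal_norm]

theorem ofReal_integral_rpow {T p : ℝ} (hp : 0 < p)
    {m : Torus N × ℝ → ℝ} (hm : ∀ᵐ p ∂volQ N T, 0 ≤ m p)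
    (hmp : MemLp m (ENNReal.ofReal p) (volQ N T)) :
    ∫⁻ x, ENNReal.ofReal (m x ^ p) ∂volQ N T = ENNReal.ofReal (∫ x, m x ^ p ∂volQ N T) := by
  have h1 := hmp.integrable_norm_rpow (by simpa using hp) ENNReal.ofReal_ne_top
  rw [ENNReal.toReal_ofReal hp.le] at h1
  have h2 : Integrable (fun x => m x ^ p) (volQ N T) := h1.congr (hm.mono fun x hx => by
    simp only [Real.norm_of_nonneg hx])
  rw [ofReal_integral_eq_lintegral_ofReal h2 (hm.mono fun x hx => Real.rpow_nonneg hx p)]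

/-- The weak-type bound for the superlevel sets of a solution: the duality estimate tested with the
indicator of the set, and optimised over the time step. -/
theorem measure_superlevel_le (hN : 1 ≤ N) {T : ℝ} {m₀ : Torus N → ℝ}
    (h₀ : ∫ x, m₀ x = 1) (hm₀ : ∀ x, 0 ≤ m₀ x) {B : ℝ} (hB0 : 0 ≤ B) (hB : ∀ x, m₀ x ≤ B)
    {A : Torus N × ℝ → EuclideanSpace ℝ (Fin N)} (hA : AEStronglyMeasurable A (volQ N T))
    {m : Torus N × ℝ → ℝ} (hm : ∀ᵐ p ∂volQ N T, 0 ≤ m p) (hw : IsWeakSolution T m₀ A m)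
    {γ' γ p p' q : ℝ} (hγ : γ'.HolderConjugate γ) (hp : p.HolderConjugate p')
    (hq : q.HolderConjugate (γ * p'))
    (hE : Integrable (fun p => ‖A p‖ ^ γ' * m p) (volQ N T))
    (hmp : MemLp m (ENNReal.ofReal p) (volQ N T))
    {C : ℝ} (hC : 0 < C) (hker : ∀ r : ℝ, 0 < r → r ≤ 1 → (gauss N).map (heatShift r)
      ≤ ENNReal.ofReal ((C / √r) ^ N) • (volume : Measure (Torus N)))
    {t : ℝ} (ht : 2 * (C ^ N + B) ≤ t) :
    volQ N T {x | t < m x} ≤ ENNReal.ofReal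
      ((2 * (N * (√2 * gaussMoment.toReal)) * (2 * (C ^ N + B)) ^ (1 / (N : ℝ))) ^ q
        * (energy T γ' A m ^ (1 / γ') * (∫ x, m x ^ p ∂volQ N T) ^ (1 / (p * γ))) ^ q
        * t ^ (-(q * (1 + 1 / N)))) := by
  have hE0 : 0 ≤ energy T γ' A m :=
    integral_nonneg_of_ae (hm.mono fun p hp => mul_nonneg (by positivity) hp)
  have hM0 : 0 ≤ ∫ x, m x ^ p ∂volQ N T :=
    integral_nonneg_of_ae (hm.mono fun x hx => Real.rpow_nonneg hx p)
  have hG : 0 < C ^ N + B := by positivity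
  have ht0 : 0 < t := by linarith
  have hM1 : ∫⁻ x, ENNReal.ofReal (m x) ^ p ∂volQ N T
      = ENNReal.ofReal (∫ x, m x ^ p ∂volQ N T) := by
    rw [← ofReal_integral_rpow hp.pos hm hmp]
    refine lintegral_congr_ae (hm.mono fun x hx => ?_)
    exact ENNReal.ofReal_rpow_of_nonneg hx hp.nonneg
  -- Pass to a measurable representative, so that the superlevel set is measurable.
  obtain ⟨f, hf, hmf⟩ := hw.integrable.aemeasurable
  have hset : volQ N T {x | t < m x} = volQ N T {x | t < f x} :=
    measure_congr (hmf.mono fun x hx => propext (by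
      change t < m x ↔ t < f x
      rw [hx]))
  set S := {x | t < f x} with hS
  have hSm : MeasurableSet S := measurableSet_lt measurable_const hf
  have hSfin : volQ N T S ≠ ⊤ := measure_ne_top _ _
  set V := (volQ N T S).toReal with hV
  have hVS : volQ N T S = ENNReal.ofReal V := (ENNReal.ofReal_toReal hSfin).symm
  have hV0 : 0 ≤ V := ENNReal.toReal_nonneg
  have hq' : p' ≤ γ * p' := le_mul_of_one_le_left hp.symm.nonneg hγ.symm.lt.le
  have hgm : gaussMoment = ENNReal.ofReal gaussMoment.toReal :=
    (ENNReal.ofReal_toReal gaussMoment_ne_top).symm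
  have main : ∀ η : ℝ, 0 < η → η ≤ 1 → t * V ≤ (C ^ N + B) * (1 / η) ^ N * V
      + (N * (√2 * gaussMoment.toReal)) * η
        * (energy T γ' A m ^ (1 / γ') * (∫ x, m x ^ p ∂volQ N T) ^ (1 / (p * γ)))
        * V ^ (1 / (γ * p')) := by
    intro η hη0 hη1
    -- The time step is `h = η²`.
    have hsq : √(η ^ 2) = η := Real.sqrt_sq hη0.le
    have hC₂ : (N : ℝ≥0∞) * (ENNReal.ofReal (√2 * √(η ^ 2)) * gaussMoment
          * ((∫⁻ p, ‖A p‖ₑ ^ γ' * ENNReal.ofReal (m p) ∂volQ N T) ^ (1 / γ')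
            * (∫⁻ x, ENNReal.ofReal (m x) ^ p ∂volQ N T) ^ (1 / (p * γ))))
        = ENNReal.ofReal ((N * (√2 * gaussMoment.toReal)) * η
          * (energy T γ' A m ^ (1 / γ') * (∫ x, m x ^ p ∂volQ N T) ^ (1 / (p * γ)))) := by
      have e1 : 0 ≤ 1 / (p * γ) := one_div_nonneg.2 (mul_nonneg hp.nonneg hγ.symm.nonneg)
      rw [ofReal_energy hγ.nonneg hm hE, hM1, hsq, hgm,
        ENNReal.ofReal_rpow_of_nonneg hE0 hγ.one_div_nonneg,
        ENNReal.ofReal_rpow_of_nonneg hM0 e1, ← ENNReal.ofReal_natCast,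
        ← ENNReal.ofReal_mul (by positivity), ← ENNReal.ofReal_mul (by positivity),
        ← ENNReal.ofReal_mul (by positivity), ← ENNReal.ofReal_mul (by positivity),
        ENNReal.toReal_ofReal ENNReal.toReal_nonneg]
      congr 1; ring
    have hC₁ : ENNReal.ofReal ((C / √(η ^ 2)) ^ N) + ENNReal.ofReal B
        = ENNReal.ofReal ((C / η) ^ N + B) := by
      rw [hsq, ENNReal.ofReal_add (by positivity) hB0]
    have h1 := setLIntegral_le_of_approx hw.integrable hm hp hq'
      (by rw [hM1]; exact ENNReal.ofReal_ne_top)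
      (C₁ := ENNReal.ofReal ((C / η) ^ N + B)) ENNReal.ofReal_ne_top
      (C₂ := ENNReal.ofReal ((N * (√2 * gaussMoment.toReal)) * η
          * (energy T γ' A m ^ (1 / γ') * (∫ x, m x ^ p ∂volQ N T) ^ (1 / (p * γ)))))
      ENNReal.ofReal_ne_top
      (by
        intro n a k θ τ hτ ha ha0
        rw [← hC₁, ← hC₂]
        exact enorm_integral_mul_trigSum_le h₀ hm₀ hB hA hm hw hγ hp (sq_nonneg η)
          (hker _ (by positivity) (by nlinarith)) hτ ha ha0 k θ)
      hSm
    have h2 : ENNReal.ofReal t * volQ N T S ≤ ∫⁻ p in S, ENNReal.ofReal (m p) ∂volQ N T := by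
      refine (ofReal_mul_measure_le hf t).trans_eq ?_
      refine lintegral_congr_ae ((ae_restrict_of_ae hmf).mono fun x hx => ?_)
      simp only [hx]
    have h3 := h2.trans h1
    rw [hVS, ENNReal.ofReal_rpow_of_nonneg hV0 (by have := hq.symm.pos; positivity),
      ← ENNReal.ofReal_mul ht0.le, ← ENNReal.ofReal_mul (by positivity),
      ← ENNReal.ofReal_mul (by positivity), ← ENNReal.ofReal_add (by positivity) (by positivity),
      ENNReal.ofReal_le_ofReal_iff (by positivity)] at h3
    refine h3.trans (add_le_add ?_ le_rfl)
    gcongr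
    have e1 : 1 ≤ (1 / η) ^ N := one_le_pow₀ (by rw [le_div_iff₀ hη0]; linarith)
    rw [div_eq_mul_one_div, mul_pow, add_mul]
    gcongr
    exact le_mul_of_one_le_right hB0 e1
  have hfinal := weak_type_of_duality hN hG (by positivity) (by positivity) hV0 ht hq main
  rw [hset, hVS]
  refine ENNReal.ofReal_le_ofReal (hfinal.trans_eq ?_)
  rw [Real.mul_rpow (by positivity) (by positivity)]

theorem measure_superlevel_le_div {T : ℝ} {m₀ : Torus N → ℝ} (h₀ : ∫ x, m₀ x = 1)
    {A : Torus N × ℝ → EuclideanSpace ℝ (Fin N)}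
    {m : Torus N × ℝ → ℝ} (hm : ∀ᵐ p ∂volQ N T, 0 ≤ m p) (hw : IsWeakSolution T m₀ A m)
    {t : ℝ} (ht : 0 < t) : volQ N T {x | t < m x} ≤ ENNReal.ofReal (T / t) := by
  rw [ENNReal.ofReal_div_of_pos ht, ← lintegral_ofReal_eq h₀ hw hm]
  refine le_trans (measure_mono fun x hx => ?_) (meas_ge_le_lintegral_div
    hw.integrable.aemeasurable.ennreal_ofReal (ENNReal.ofReal_pos.2 ht).ne' ENNReal.ofReal_ne_top)
  exact ENNReal.ofReal_le_ofReal (le_of_lt hx)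

end

end FokkerPlanck

theorem proposition2p5 (N : ℕ) (hN : 1 ≤ N) (T : ℝ) (hT : 0 < T) (γ' : ℝ) (hγ' : 1 < γ')
    (α : ℝ) (hα0 : 0 ≤ α) (hα : α < γ' / N) (K : ℝ) :
    ∃ C : ℝ, 0 < C ∧ ∃ δ : ℝ, 1 < δ ∧
      ∀ (m₀ : FokkerPlanck.Torus N → ℝ)
        (m : FokkerPlanck.Torus N × ℝ → ℝ)
        (A : FokkerPlanck.Torus N × ℝ → EuclideanSpace ℝ (Fin N)),
        -- the initial datum: a positive probability density of class `C²`, with `‖∇m₀‖_∞ ≤ K`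
        FokkerPlanck.TorusContDiff 2 m₀ →
        (∀ x, 0 < m₀ x) →
        ∫ x, m₀ x = 1 →
        (∀ x, ‖FokkerPlanck.torusGradient m₀ x‖ ≤ K) →
        -- the drift, and the nonnegative weak solution with finite energy in `L^{α+1}(Q)`
        AEStronglyMeasurable A (FokkerPlanck.volQ N T) →
        (∀ᵐ p ∂(FokkerPlanck.volQ N T), 0 ≤ m p) →
        FokkerPlanck.IsWeakSolution T m₀ A m →
        Integrable (fun p => ‖A p‖ ^ γ' * m p) (FokkerPlanck.volQ N T) →
        MemLp m (ENNReal.ofReal (α + 1)) (FokkerPlanck.volQ N T) →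
        (∫ p, m p ^ (α + 1) ∂(FokkerPlanck.volQ N T)) ^ δ
          ≤ C * (FokkerPlanck.energy T γ' A m + 1) := by
  have hN0 : (0 : ℝ) < N := by exact_mod_cast hN
  have hE0 : ∀ (m : FokkerPlanck.Torus N × ℝ → ℝ)
      (A : FokkerPlanck.Torus N × ℝ → EuclideanSpace ℝ (Fin N)),
      (∀ᵐ p ∂FokkerPlanck.volQ N T, 0 ≤ m p) → 0 ≤ FokkerPlanck.energy T γ' A m :=
    fun m A hm => integral_nonneg_of_ae (hm.mono fun p hp => mul_nonneg (by positivity) hp)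
  rcases hα0.eq_or_lt with rfl | hα0
  · -- For `α = 0` the left-hand side is a power of the total mass `T`.
    refine ⟨T ^ (2 : ℝ) + 1, by positivity, 2, one_lt_two, ?_⟩
    intro m₀ m A _ _ h₀ _ _ hm hw _ _
    have h1 : ∫ p, m p ^ ((0 : ℝ) + 1) ∂FokkerPlanck.volQ N T = T := by
      have h2 := FokkerPlanck.lintegral_ofReal_eq h₀ hw hm
      rw [← ofReal_integral_eq_lintegral_ofReal hw.integrable hm,
        ENNReal.ofReal_eq_ofReal_iff (integral_nonneg_of_ae hm) hT.le] at h2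
      simpa using h2
    rw [h1]
    have hT2 : 0 ≤ T ^ (2 : ℝ) := Real.rpow_nonneg hT.le 2
    nlinarith [hE0 m A hm, mul_nonneg hT2 (hE0 m A hm)]
  set p := α + 1 with hp
  have hp1 : 1 < p := by linarith
  set γ := γ'.conjExponent with hγdef
  have hγ : γ'.HolderConjugate γ := Real.HolderConjugate.conjExponent hγ'
  set p' := p.conjExponent with hp'def
  have hpc : p.HolderConjugate p' := Real.HolderConjugate.conjExponent hp1
  have hγp : 1 < γ * p' := by nlinarith [hγ.symm.lt, hpc.symm.lt]
  set q := (γ * p').conjExponent with hqdef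
  have hq : q.HolderConjugate (γ * p') := (Real.HolderConjugate.conjExponent hγp).symm
  have hγ0 : 0 < γ := hγ.symm.pos
  have hp0 : 0 < p := by linarith
  have hq0 : 0 < q := hq.pos
  have hγ'0 : 0 < γ' := by linarith
  -- `1/q = 1/γ' + 1/(γp)`
  have hexp : 1 / q = 1 / γ' + 1 / (p * γ) := by
    have h1 := hq.inv_add_inv_eq_one
    have h2 := hγ.inv_add_inv_eq_one
    have h3 := hpc.inv_add_inv_eq_one
    rw [mul_inv] at h1
    rw [one_div, one_div, one_div, mul_inv]
    have h4 : p'⁻¹ = 1 - p⁻¹ := by linarith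
    rw [h4] at h1
    linear_combination h1 - h2
  set κ := q / γ' with hκ
  have hκ1 : 1 - κ = q / (p * γ) := by
    have : q * (1 / q) = q * (1 / γ' + 1 / (p * γ)) := by rw [hexp]
    rw [mul_one_div_cancel hq0.ne'] at this
    rw [hκ]
    linear_combination this
  have hκ0 : 0 < κ := by positivity
  have hκlt : κ < 1 := by
    have : 0 < q / (p * γ) := by positivity
    linarith
  -- The weak-type exponent `r` exceeds `p` exactly because `α < γ' / N`.
  set r := q * (1 + 1 / N) with hr
  have hrp : p < r := by
    have h1 : p = q * (p * (1 / q)) := by field_simp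
    have h2 : p * (1 / q) = 1 + α / γ' := by
      have h3 : p * (1 / (p * γ)) = 1 / γ := by field_simp
      have h4 := hγ.inv_add_inv_eq_one
      rw [← one_div, ← one_div] at h4
      rw [hexp, mul_add, h3, hp]
      linear_combination h4
    have h5 : α / γ' < 1 / N := by
      rw [div_lt_div_iff₀ hγ'0 hN0]
      rw [lt_div_iff₀ hN0] at hα
      linarith
    calc p = q * (1 + α / γ') := by rw [← h2]; exact h1
      _ < r := by rw [hr]; gcongr
  have hr1 : 0 < r - 1 := by linarith
  obtain ⟨Ck, hCk, hker⟩ := FokkerPlanck.exists_map_heatShift_le N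
  set B := 1 + |K| * √N with hB
  have hB0 : 0 ≤ B := by positivity
  set W₀ := (2 * (N * (√2 * FokkerPlanck.gaussMoment.toReal))
    * (2 * (Ck ^ N + B)) ^ (1 / (N : ℝ))) ^ q with hW₀
  obtain ⟨C, hC, hinterp⟩ := FokkerPlanck.exists_le_rpow_of_interpolation (T := T) (W₀ := W₀)
    (Λ₀ := 2 * (Ck ^ N + B)) hp1 hrp hT.le (by positivity)
  obtain ⟨C', hC', δ, hδ, habs⟩ := FokkerPlanck.exists_rpow_le_of_absorption hC
    (θ := (p - 1) / (r - 1)) (div_pos (by linarith) hr1) ((div_lt_one hr1).2 (by linarith))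
    hκ0 hκlt
  refine ⟨C', hC', δ, hδ, ?_⟩
  intro m₀ m A hm₀ hpos h₀ hK hA hm hw hE hmp
  have hM0 : 0 ≤ ∫ x, m x ^ p ∂FokkerPlanck.volQ N T :=
    integral_nonneg_of_ae (hm.mono fun x hx => Real.rpow_nonneg hx p)
  have hmB : ∀ x, m₀ x ≤ B := fun x =>
    (FokkerPlanck.le_of_norm_torusGradient_le hm₀ h₀ hK x).trans
      (by rw [hB]; gcongr; exact le_abs_self K)
  refine habs _ _ hM0 (hE0 m A hm) (hinterp _ _ (mul_nonneg (Real.rpow_nonneg (hE0 m A hm) _)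
    (Real.rpow_nonneg hM0 _)) fun Λ hΛ0 hΛ => ?_)
  -- The `q`-th power of the Hölder bound for the flux.
  have hY : (FokkerPlanck.energy T γ' A m ^ (1 / γ')
        * (∫ x, m x ^ p ∂FokkerPlanck.volQ N T) ^ (1 / (p * γ))) ^ q
      = FokkerPlanck.energy T γ' A m ^ κ * (∫ x, m x ^ p ∂FokkerPlanck.volQ N T) ^ (1 - κ) := by
    rw [Real.mul_rpow (Real.rpow_nonneg (hE0 m A hm) _) (Real.rpow_nonneg hM0 _),
      ← Real.rpow_mul (hE0 m A hm), ← Real.rpow_mul hM0, hκ1, hκ, one_div_mul_eq_div,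
      one_div_mul_eq_div]
  have hY0 : 0 ≤ FokkerPlanck.energy T γ' A m ^ κ
      * (∫ x, m x ^ p ∂FokkerPlanck.volQ N T) ^ (1 - κ) :=
    mul_nonneg (Real.rpow_nonneg (hE0 m A hm) _) (Real.rpow_nonneg hM0 _)
  have hW₀0 : 0 ≤ W₀ := by positivity
  have hcake := FokkerPlanck.lintegral_rpow_le_of_weak_type (f := m) (T := T) (r := r)
    (W := W₀ * (FokkerPlanck.energy T γ' A m ^ κ
      * (∫ x, m x ^ p ∂FokkerPlanck.volQ N T) ^ (1 - κ)))
    hw.integrable.aemeasurable hm hp1 hrp hT.le (mul_nonneg hW₀0 hY0) hΛ0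
    (fun t ht => FokkerPlanck.measure_superlevel_le_div h₀ hm hw ht)
    (fun t ht => by
      rw [← hY]
      exact FokkerPlanck.measure_superlevel_le hN h₀ (fun x => (hpos x).le) hB0 hmB hA hm hw hγ hpc
        hq hE hmp hCk hker (hΛ.trans ht))
  rw [FokkerPlanck.ofReal_integral_rpow hp0 hm hmp, ENNReal.ofReal_le_ofReal_iff] at hcake
  · exact hcake
  · have : 0 < r - p := by linarith
    have : 0 < p - 1 := by linarith
    have := mul_nonneg hW₀0 hY0
    positivity
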